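/- Let $0\le d\le n$ be integers, let $\mathcal M\subset\mathbb R^n$ be a $d$-dimensional embedded $C^1$ submanifold without boundary, and let $\mathbf x$ be a random variable on $\mathcal M$ whose law has a continuous density $p:\mathcal M\to[0,\infty)$ with respect to the $d$-dimensional volume (Hausdorff) measure of $\mathcal M$. For $\sigma>0$ let $\tilde{\mathbf x}=\mathbf x+\sigma\boldsymbol\epsilon$, where $\boldsymbol\epsilon\sim\mathcal N(\mathbf 0,\mathbf I_n)$ is independent of $\mathbf x$, and for a differentiable vector field $s:\mathbb R^n\to\mathbb R^n$ put $$\mathcal L_{\mathrm{ISM}}(x,\sigma,s):=\sigma^2\Big(\nabla\cdot s(x)+\tfrac12\|s(x)\|^2\Big).$$ (i) If $d<n$, there is $\sigma_0>0$, depending only on $\mathcal M$ and $p$, such that for every $0<\sigma<\sigma_0$ and every differentiable $s:\mathbb R^n\to\mathbb R^n$ for which $\mathcal L_{\mathrm{ISM}}(\tilde{\mathbf x},\sigma,s)$ is integrable, $$\mathbb E_{\tilde{\mathbf x}}\big[\mathcal L_{\mathrm{ISM}}(\tilde{\mathbf x},\sigma,s)\big]\ \ge\ -(n-d).$$ (ii)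 For every $d\le n$ (in particular for $d=n$) and every $\delta>0$ there is $\sigma_0>0$, depending only on $\mathcal M$, $p$ and $\delta$, such that for every $0<\sigma<\sigma_0$ and every such $s$, $$\mathbb E_{\tilde{\mathbf x}}\big[\mathcal L_{\mathrm{ISM}}(\tilde{\mathbf x},\sigma,s)\big]\ \ge\ -(n-d)-\delta .$$ -/

import Mathlib

open MeasureTheory ProbabilityTheory Set

noncomputable section

/-- `M` is a `d`-dimensional embedded `C¹` submanifold (without boundary) of `ℝⁿ`: around each of
its points there is a `C¹` diffeomorphism `Φ` between open subsets of `ℝⁿ` which straightens `M`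
to the coordinate subspace `ℝᵈ × {0}`. -/
def IsEmbeddedSubmanifold {n : ℕ} (d : ℕ) (M : Set (EuclideanSpace ℝ (Fin n))) : Prop :=
  ∀ x ∈ M, ∃ Φ : OpenPartialHomeomorph (EuclideanSpace ℝ (Fin n)) (EuclideanSpace ℝ (Fin n)),
    x ∈ Φ.source ∧ ContDiffOn ℝ 1 Φ Φ.source ∧ ContDiffOn ℝ 1 Φ.symm Φ.target ∧
      ∀ y ∈ Φ.source, (y ∈ M ↔ ∀ i : Fin n, d ≤ (i : ℕ) → Φ y i = 0)

/-- The measure on `ℝⁿ` which is carried by `M` and has density `p` with respect to the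
`d`-dimensional volume (normalized `d`-dimensional Hausdorff measure) of `M`. -/
def dataMeasure {n : ℕ} (d : ℕ) (M : Set (EuclideanSpace ℝ (Fin n)))
    (p : EuclideanSpace ℝ (Fin n) → ℝ) : Measure (EuclideanSpace ℝ (Fin n)) :=
  ((Measure.euclideanHausdorffMeasure d).restrict M).withDensity fun x => ENNReal.ofReal (p x)

/-- The noised distribution `μ * N(0, σ² I)`, i.e. the law of `x + σ ε` for independent `x ∼ μ`
and standard Gaussian `ε`. -/
def noised {n : ℕ} (μ : Measure (EuclideanSpace ℝ (Fin n))) (σ : ℝ) :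
    Measure (EuclideanSpace ℝ (Fin n)) :=
  Measure.conv μ ((stdGaussian (EuclideanSpace ℝ (Fin n))).map fun e => σ • e)

/-- The divergence `∇ · s = ∑ᵢ ∂sᵢ/∂xᵢ` of a vector field on `ℝⁿ`. -/
def divergence {n : ℕ} (s : EuclideanSpace ℝ (Fin n) → EuclideanSpace ℝ (Fin n))
    (x : EuclideanSpace ℝ (Fin n)) : ℝ :=
  ∑ i : Fin n, fderiv ℝ s x (EuclideanSpace.single i 1) i

/-- The pointwise implicit score matching loss, scaled by `σ²`. -/
def ismLoss {n : ℕ} (σ : ℝ) (s : EuclideanSpace ℝ (Fin n) → EuclideanSpace ℝ (Fin n))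
    (x : EuclideanSpace ℝ (Fin n)) : ℝ :=
  σ ^ 2 * (divergence s x + (1 / 2) * ‖s x‖ ^ 2)

end

/-!
Write `q_σ` for the density of `μ * N(0, σ² I)`. Completing the square in `∇ · s + ‖s‖² / 2` and
integrating by parts shows that the expected loss is at least `-σ² J(q_σ) / 2`, where
`J(q) = ∫ ‖∇q‖² / q` is the Fisher information (`neg_half_fisher_le_integral_ismLoss`). The field
`s` is merely differentiable and only the whole loss is integrable, so this is done with a cutoff
and with the divergence theorem for differentiable fields with integrable divergence.

In a unit direction `b`, the ratio `σ ∂_b q_σ / q_σ` is minus the posterior mean of the noise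
component `⟪ε, b⟫` given the noisy observation. By Jensen, each direction contributes at most the
mass of `μ` to `σ² J` (`dirFisher_le`), so it remains to see that tangent directions contribute
nothing in the limit. Since the posterior mean also has a bounded fourth moment, it is enough that
`σ ∂_b q_σ` is small in `L¹` (`dirFisher_le_lintegral`), which is a condition linear in `μ`. If `μ`
is the image of an absolutely continuous measure under a patch `ψ` whose tangent spaces almost
contain `b`, then the density of that measure is close in `L¹` to a `C¹` weight, and for such a
weight the derivative of the Gaussian along `b` can be moved to the weight, up to a small error
(`eventually_lintegral_kernelConv_map_le`).

A measure `μ ≪ H^d` on the submanifold is of this form near every point, because the patch is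
Lipschitz and so maps Lebesgue null sets to `H^d` null sets (`exists_nhds_eventuallyLossGe`); no
area formula is needed. The loss is linear in `μ`, hence finitely many disjoint pieces of small
patches can be added up, and the crude bound `-n / 2` per unit mass takes care of the remaining
small mass (`eventually_integral_ismLoss_ge`). The limiting constant is `-(n - d) / 2`, half of what
is claimed, which is why no error term is needed when `d < n`.
-/

open Filter Topology Module
open scoped RealInnerProductSpace ENNReal

set_option linter.unusedSectionVars false

/-! ### The Gaussian density and its moments -/

section Gaussian

variable {E : Type*} [NormedAddCommGroup E] [InnerProductSpace ℝ E] [FiniteDimensional ℝ E]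
  [MeasurableSpace E] [BorelSpace E]

/-- The density of the centred Gaussian law `N(0, σ² I)` with respect to Lebesgue measure. -/
noncomputable def gaussDensity (σ : ℝ) (z : E) : ℝ :=
  ((2 * Real.pi * σ ^ 2) ^ (finrank ℝ E / 2 : ℝ))⁻¹ * Real.exp (-(2 * σ ^ 2)⁻¹ * ‖z‖ ^ 2)

lemma gaussDensity_pos {σ : ℝ} (hσ : 0 < σ) (z : E) : 0 < gaussDensity σ z := by
  unfold gaussDensity; positivity

lemma continuous_gaussDensity (σ : ℝ) : Continuous (gaussDensity σ : E → ℝ) := by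
  unfold gaussDensity; fun_prop

lemma integrable_gaussDensity {σ : ℝ} (hσ : 0 < σ) :
    Integrable (gaussDensity σ : E → ℝ) := by
  unfold gaussDensity
  have hb : 0 < (2 * σ ^ 2)⁻¹ := by positivity
  have h := (GaussianFourier.integrable_cexp_neg_mul_sq_norm_add
      (b := ((2 * σ ^ 2)⁻¹ : ℝ)) (by rwa [Complex.ofReal_re]) 0 (0 : E)).norm
  refine (h.congr (Eventually.of_forall fun z => ?_)).const_mul _
  have : (-(((2 * σ ^ 2)⁻¹ : ℝ) : ℂ) * (‖z‖ : ℂ) ^ 2 + 0 * ((⟪(0 : E), z⟫ : ℝ) : ℂ)) =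
    ((-(2 * σ ^ 2)⁻¹ * ‖z‖ ^ 2 : ℝ) : ℂ) := by push_cast; ring
  simp only [Complex.norm_exp]
  rw [this, Complex.ofReal_re]

/-- Both measures have characteristic function `t ↦ exp (-σ² ‖t‖² / 2)`. -/
lemma map_smul_stdGaussian {σ : ℝ} (hσ : 0 < σ) :
    (stdGaussian E).map (fun e => σ • e) =
      volume.withDensity fun z => ENNReal.ofReal (gaussDensity σ z) := by
  have : IsFiniteMeasure (volume.withDensity fun z : E => ENNReal.ofReal (gaussDensity σ z)) :=
    isFiniteMeasure_withDensity_ofReal (integrable_gaussDensity hσ).2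
  have : IsProbabilityMeasure ((stdGaussian E).map (fun e => σ • e)) :=
    Measure.isProbabilityMeasure_map (by fun_prop)
  have hb : 0 < (2 * σ ^ 2)⁻¹ := by positivity
  refine Measure.ext_of_charFun (funext fun t => ?_)
  rw [charFun_map_smul, charFun_stdGaussian, charFun_apply,
    integral_withDensity_eq_integral_toReal_smul
      (continuous_gaussDensity σ).measurable.ennreal_ofReal (by simp)]
  have key := GaussianFourier.integral_cexp_neg_mul_sq_norm_add
      (b := ((2 * σ ^ 2)⁻¹ : ℝ)) (by rwa [Complex.ofReal_re]) Complex.I t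
  have h1 : ∀ z : E, (ENNReal.ofReal (gaussDensity σ z)).toReal •
        Complex.exp (⟪z, t⟫ * Complex.I) =
      ((((2 * Real.pi * σ ^ 2) ^ (finrank ℝ E / 2 : ℝ))⁻¹ : ℝ) : ℂ) *
        Complex.exp (-(((2 * σ ^ 2)⁻¹ : ℝ) : ℂ) * (‖z‖ : ℂ) ^ 2 +
          Complex.I * ((⟪t, z⟫ : ℝ) : ℂ)) := by
    intro z
    rw [ENNReal.toReal_ofReal (gaussDensity_pos hσ z).le, gaussDensity, Complex.exp_add,
      Complex.real_smul, real_inner_comm]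
    push_cast
    rw [mul_comm (Complex.I)]
    ring
  simp_rw [h1]
  rw [integral_const_mul, key]
  have h2 : (Real.pi / (((2 * σ ^ 2)⁻¹ : ℝ) : ℂ)) ^ (finrank ℝ E / 2 : ℂ) =
      (((2 * Real.pi * σ ^ 2) ^ (finrank ℝ E / 2 : ℝ) : ℝ) : ℂ) := by
    rw [Complex.ofReal_cpow (by positivity)]
    congr 1
    · push_cast; field_simp
    · push_cast; rfl
  rw [h2, ← mul_assoc, ← Complex.ofReal_mul, inv_mul_cancel₀ (by positivity), Complex.ofReal_one,
    one_mul]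
  congr 1
  simp only [norm_smul, Real.norm_eq_abs, abs_of_pos hσ, Complex.I_sq]
  push_cast
  have : (σ : ℂ) ≠ 0 := by exact_mod_cast hσ.ne'
  field_simp
  norm_num

lemma lintegral_mul_gaussDensity {σ : ℝ} (hσ : 0 < σ) {F : E → ℝ≥0∞} (hF : Measurable F) :
    ∫⁻ z, F z * ENNReal.ofReal (gaussDensity σ z) = ∫⁻ e, F (σ • e) ∂stdGaussian E := by
  rw [← lintegral_map (f := F) (g := fun e : E => σ • e) hF (by fun_prop), map_smul_stdGaussian hσ,
    lintegral_withDensity_eq_lintegral_mul _ (continuous_gaussDensity σ).measurable.ennreal_ofReal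
      hF]
  simp [mul_comm]

lemma lintegral_inner_sq_stdGaussian (v : E) :
    ∫⁻ e, ENNReal.ofReal (⟪e, v⟫ ^ 2) ∂stdGaussian E = ENNReal.ofReal (‖v‖ ^ 2) := by
  have hint : MemLp (innerSL ℝ v) 2 (stdGaussian E) :=
    (IsGaussian.memLp_two_id (μ := stdGaussian E)).continuousLinearMap_comp (innerSL ℝ v)
  have h := variance_dual_stdGaussian (innerSL ℝ v)
  rw [variance_of_integral_eq_zero hint.1.aemeasurable (integral_strongDual_stdGaussian _)] at h
  rw [← ofReal_integral_eq_lintegral_ofReal]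
  · congr 1
    simpa [real_inner_comm] using h
  · simpa [real_inner_comm] using hint.integrable_sq
  · exact Eventually.of_forall fun e => sq_nonneg _

/-- The function `⟪z, v⟫ / σ * G_σ(z)`, which is `-σ` times the derivative along `v` of the
Gaussian density `G_σ`. -/
noncomputable def gaussKernel (σ : ℝ) (v z : E) : ℝ := ⟪z, v⟫ / σ * gaussDensity σ z

lemma lintegral_inner_pow_mul_gaussDensity {σ : ℝ} (hσ : 0 < σ) (v : E) (k : ℕ) :
    ∫⁻ z, ENNReal.ofReal (|⟪z, v⟫ / σ| ^ k) * ENNReal.ofReal (gaussDensity σ z) =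
      ∫⁻ e, ENNReal.ofReal (|⟪e, v⟫| ^ k) ∂stdGaussian E := by
  rw [lintegral_mul_gaussDensity hσ (by fun_prop)]
  congr 1 with e
  rw [real_inner_smul_left, mul_div_cancel_left₀ _ hσ.ne']

lemma lintegral_abs_inner_stdGaussian_le (v : E) :
    ∫⁻ e, ENNReal.ofReal (|⟪e, v⟫| ^ 1) ∂stdGaussian E ≤ ENNReal.ofReal ‖v‖ := by
  rcases eq_or_ne v 0 with rfl | hv
  · simp
  have hv' : 0 < ‖v‖ := norm_pos_iff.2 hv
  have hpt : ∀ e : E, ENNReal.ofReal (|⟪e, v⟫| ^ 1) ≤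
      ENNReal.ofReal (2 * ‖v‖)⁻¹ * ENNReal.ofReal (⟪e, v⟫ ^ 2) + ENNReal.ofReal (‖v‖ / 2) := by
    intro e
    rw [← ENNReal.ofReal_mul (by positivity), ← ENNReal.ofReal_add (by positivity) (by positivity)]
    apply ENNReal.ofReal_le_ofReal
    rw [pow_one, ← sq_abs]
    have : 0 ≤ (2 * ‖v‖)⁻¹ * (|⟪e, v⟫| - ‖v‖) ^ 2 := by positivity
    have e1 : (2 * ‖v‖)⁻¹ * (|⟪e, v⟫| - ‖v‖) ^ 2 =
      (2 * ‖v‖)⁻¹ * |⟪e, v⟫| ^ 2 - |⟪e, v⟫| + ‖v‖ / 2 := by field_simp; ring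
    linarith
  refine (lintegral_mono hpt).trans ?_
  rw [lintegral_add_right _ (by fun_prop), lintegral_const_mul _ (by fun_prop),
    lintegral_inner_sq_stdGaussian, lintegral_const, measure_univ, mul_one,
    ← ENNReal.ofReal_mul (by positivity), ← ENNReal.ofReal_add (by positivity) (by positivity)]
  apply le_of_eq
  congr 1
  field_simp
  norm_num

lemma lintegral_enorm_gaussKernel_le {σ : ℝ} (hσ : 0 < σ) (v : E) :
    ∫⁻ z, ‖gaussKernel σ v z‖ₑ ≤ ENNReal.ofReal ‖v‖ := by
  refine le_trans (le_of_eq ?_) (lintegral_abs_inner_stdGaussian_le v)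
  rw [← lintegral_inner_pow_mul_gaussDensity hσ]
  congr 1 with z
  rw [gaussKernel, ← ofReal_norm, norm_mul, ENNReal.ofReal_mul (norm_nonneg _), pow_one,
    Real.norm_eq_abs, Real.norm_eq_abs, abs_of_pos (gaussDensity_pos hσ z)]

variable (E) in
/-- The fourth moment of the norm of a standard Gaussian vector. -/
noncomputable def gaussFourthMoment : ℝ := ∫ e, ‖e‖ ^ 4 ∂stdGaussian E

lemma lintegral_inner_pow_four_stdGaussian_le (v : E) (hv : ‖v‖ ≤ 1) :
    ∫⁻ e, ENNReal.ofReal (|⟪e, v⟫| ^ 4) ∂stdGaussian E ≤ ENNReal.ofReal (gaussFourthMoment E) := by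
  have hint : Integrable (fun e : E => ‖e‖ ^ 4) (stdGaussian E) := by
    have := (IsGaussian.memLp_id (stdGaussian E) 4 (by norm_num)).integrable_norm_pow (by norm_num)
    simpa using this
  rw [gaussFourthMoment, ofReal_integral_eq_lintegral_ofReal hint
    (Eventually.of_forall fun e => by positivity)]
  refine lintegral_mono fun e => ENNReal.ofReal_le_ofReal ?_
  gcongr
  refine (abs_real_inner_le_norm e v).trans ?_
  exact mul_le_of_le_one_right (norm_nonneg _) hv

lemma gaussFourthMoment_nonneg : 0 ≤ gaussFourthMoment E :=
  integral_nonneg fun e => by positivity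

lemma continuous_gaussKernel (σ : ℝ) (v : E) : Continuous (gaussKernel σ v) := by
  have := continuous_gaussDensity (E := E) σ
  unfold gaussKernel; fun_prop

lemma hasFDerivAt_gaussDensity {σ : ℝ} (hσ : 0 < σ) (z : E) :
    HasFDerivAt (gaussDensity σ) (-((gaussDensity σ z / σ ^ 2) • innerSL ℝ z)) z := by
  have h := (((hasStrictFDerivAt_norm_sq z).hasFDerivAt.const_mul
    (-(2 * σ ^ 2)⁻¹)).exp.const_mul ((2 * Real.pi * σ ^ 2) ^ (finrank ℝ E / 2 : ℝ))⁻¹)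
  refine h.congr_fderiv ?_
  ext v
  simp [gaussDensity]
  field_simp

lemma gaussDensity_le {σ : ℝ} (hσ : 0 < σ) (z : E) : gaussDensity σ z ≤ gaussDensity σ (0 : E) := by
  unfold gaussDensity
  have h : (2 * Real.pi * σ ^ 2) ^ (finrank ℝ E / 2 : ℝ) ≥ 0 := by positivity
  refine mul_le_mul_of_nonneg_left (Real.exp_le_exp.2 ?_) (inv_nonneg.2 h)
  have : 0 ≤ (2 * σ ^ 2)⁻¹ * ‖z‖ ^ 2 := by positivity
  rw [norm_zero]
  linarith

lemma norm_mul_gaussDensity_le {σ : ℝ} (hσ : 0 < σ) (z : E) :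
    ‖z‖ * gaussDensity σ z ≤ σ * gaussDensity σ (0 : E) := by
  have h : ‖z‖ / σ * Real.exp (-(2 * σ ^ 2)⁻¹ * ‖z‖ ^ 2) ≤ 1 := by
    have h1 : ‖z‖ / σ ≤ Real.exp ((2 * σ ^ 2)⁻¹ * ‖z‖ ^ 2) := by
      refine le_trans ?_ (Real.add_one_le_exp _)
      have : 0 ≤ (‖z‖ / σ - 1) ^ 2 := sq_nonneg _
      have e : (2 * σ ^ 2)⁻¹ * ‖z‖ ^ 2 = (‖z‖ / σ) ^ 2 / 2 := by field_simp
      rw [e]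
      nlinarith
    rw [neg_mul, Real.exp_neg, ← div_eq_mul_inv, div_le_one (Real.exp_pos _)]
    exact h1
  unfold gaussDensity
  simp only [norm_zero, ne_eq, OfNat.ofNat_ne_zero, not_false_eq_true, zero_pow, mul_zero,
    Real.exp_zero, mul_one]
  have hc : 0 < ((2 * Real.pi * σ ^ 2) ^ (finrank ℝ E / 2 : ℝ))⁻¹ := by positivity
  calc _ = σ * ((2 * Real.pi * σ ^ 2) ^ (finrank ℝ E / 2 : ℝ))⁻¹ *
        (‖z‖ / σ * Real.exp (-(2 * σ ^ 2)⁻¹ * ‖z‖ ^ 2)) := by field_simp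
    _ ≤ σ * ((2 * Real.pi * σ ^ 2) ^ (finrank ℝ E / 2 : ℝ))⁻¹ * 1 := by gcongr
    _ = _ := by ring

end Gaussian

/-! ### Gaussian smoothing and directional Fisher information -/

section Smoothed

variable {E : Type*} [NormedAddCommGroup E] [InnerProductSpace ℝ E] [FiniteDimensional ℝ E]
  [MeasurableSpace E] [BorelSpace E]

/-- The density of `μ * N(0, σ² I)` with respect to Lebesgue measure. -/
noncomputable def smoothed (μ : Measure E) (σ : ℝ) (y : E) : ℝ := ∫ x, gaussDensity σ (y - x) ∂μ

/-- The convolution of `μ` with `gaussKernel σ v`; equals `-σ` times the derivative of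
`smoothed μ σ` along `v`. -/
noncomputable def kernelConv (μ : Measure E) (σ : ℝ) (v y : E) : ℝ :=
  ∫ x, gaussKernel σ v (y - x) ∂μ

lemma integrable_gaussDensity_sub (μ : Measure E) [IsFiniteMeasure μ] {σ : ℝ} (hσ : 0 < σ) (y : E) :
    Integrable (fun x => gaussDensity σ (y - x)) μ := by
  refine Integrable.of_bound
    ((continuous_gaussDensity σ).comp
      (by fun_prop : Continuous fun x => y - x)).aestronglyMeasurable
    (gaussDensity σ (0 : E)) (Eventually.of_forall fun x => ?_)
  rw [Real.norm_eq_abs, abs_of_pos (gaussDensity_pos hσ _)]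
  exact gaussDensity_le hσ _

lemma norm_gaussKernel_le {σ : ℝ} (hσ : 0 < σ) (v z : E) :
    ‖gaussKernel σ v z‖ ≤ ‖v‖ * gaussDensity σ (0 : E) := by
  rw [gaussKernel, norm_mul, norm_div, Real.norm_eq_abs, Real.norm_eq_abs, Real.norm_eq_abs,
    abs_of_pos hσ, abs_of_pos (gaussDensity_pos hσ _)]
  calc |⟪z, v⟫| / σ * gaussDensity σ z ≤ (‖z‖ * ‖v‖) / σ * gaussDensity σ z := by
        gcongr
        · exact (gaussDensity_pos hσ z).le
        · exact abs_real_inner_le_norm _ _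
    _ = ‖v‖ / σ * (‖z‖ * gaussDensity σ z) := by ring
    _ ≤ ‖v‖ / σ * (σ * gaussDensity σ (0 : E)) := by
        exact mul_le_mul_of_nonneg_left (norm_mul_gaussDensity_le hσ z) (by positivity)
    _ = _ := by field_simp

lemma integrable_gaussKernel_sub (μ : Measure E) [IsFiniteMeasure μ] {σ : ℝ} (hσ : 0 < σ)
    (v y : E) : Integrable (fun x => gaussKernel σ v (y - x)) μ :=
  Integrable.of_bound
    ((continuous_gaussKernel σ v).comp
      (by fun_prop : Continuous fun x => y - x)).aestronglyMeasurable
    (‖v‖ * gaussDensity σ (0 : E)) (Eventually.of_forall fun _ => norm_gaussKernel_le hσ _ _)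

lemma smoothed_nonneg (μ : Measure E) {σ : ℝ} (hσ : 0 < σ) (y : E) : 0 ≤ smoothed μ σ y :=
  integral_nonneg fun _ => (gaussDensity_pos hσ _).le

lemma smoothed_pos (μ : Measure E) [IsFiniteMeasure μ] (hμ : μ ≠ 0) {σ : ℝ} (hσ : 0 < σ) (y : E) :
    0 < smoothed μ σ y := by
  refine (integral_pos_iff_support_of_nonneg (fun _ => (gaussDensity_pos hσ _).le)
    (integrable_gaussDensity_sub μ hσ y)).2 ?_
  have : Function.support (fun x => gaussDensity σ (y - x)) = univ :=
    eq_univ_of_forall fun x => (gaussDensity_pos hσ _).ne'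
  rw [this]
  exact Measure.measure_univ_pos.2 hμ

lemma hasFDerivAt_smoothed (μ : Measure E) [IsFiniteMeasure μ] {σ : ℝ} (hσ : 0 < σ) (y : E) :
    HasFDerivAt (smoothed μ σ)
      (∫ x, -((gaussDensity σ (y - x) / σ ^ 2) • innerSL ℝ (y - x)) ∂μ) y ∧
    Integrable (fun x => -((gaussDensity σ (y - x) / σ ^ 2) • innerSL ℝ (y - x))) μ := by
  have hmeas : AEStronglyMeasurable
      (fun x => -((gaussDensity σ (y - x) / σ ^ 2) • innerSL ℝ (y - x))) μ := by
    have := (continuous_gaussDensity (E := E) σ).comp (by fun_prop : Continuous fun x => y - x)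
    exact Continuous.aestronglyMeasurable
      ((this.div_const _).smul (by fun_prop)).neg
  have hbound : ∀ z : E, ‖-((gaussDensity σ z / σ ^ 2) • innerSL ℝ z)‖ ≤
      (σ ^ 2)⁻¹ * (σ * gaussDensity σ (0 : E)) := by
    intro z
    rw [norm_neg, norm_smul, innerSL_apply_norm, Real.norm_eq_abs,
      abs_of_pos (div_pos (gaussDensity_pos hσ z) (by positivity)), div_eq_inv_mul, mul_assoc,
      mul_comm (gaussDensity σ z)]
    exact mul_le_mul_of_nonneg_left (norm_mul_gaussDensity_le hσ z) (by positivity)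
  refine ⟨?_, Integrable.of_bound hmeas _ (Eventually.of_forall fun _ => hbound _)⟩
  refine hasFDerivAt_integral_of_dominated_of_fderiv_le (s := univ) univ_mem
    (F := fun y x => gaussDensity σ (y - x))
    (F' := fun y x => -((gaussDensity σ (y - x) / σ ^ 2) • innerSL ℝ (y - x)))
    (Eventually.of_forall fun y' => (integrable_gaussDensity_sub μ hσ y').1)
    (integrable_gaussDensity_sub μ hσ y) hmeas
    (Eventually.of_forall fun _ _ _ => hbound _) (integrable_const _)
    (Eventually.of_forall fun x y' _ => ?_)
  exact (hasFDerivAt_gaussDensity hσ (y' - x)).comp y' ((hasFDerivAt_id y').sub_const x)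

lemma differentiable_smoothed (μ : Measure E) [IsFiniteMeasure μ] {σ : ℝ} (hσ : 0 < σ) :
    Differentiable ℝ (smoothed μ σ) :=
  fun y => (hasFDerivAt_smoothed μ hσ y).1.differentiableAt

lemma fderiv_smoothed_apply (μ : Measure E) [IsFiniteMeasure μ] {σ : ℝ} (hσ : 0 < σ) (y v : E) :
    σ * fderiv ℝ (smoothed μ σ) y v = -kernelConv μ σ v y := by
  rw [(hasFDerivAt_smoothed μ hσ y).1.fderiv,
    ContinuousLinearMap.integral_apply (hasFDerivAt_smoothed μ hσ y).2, kernelConv,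
    ← integral_const_mul, ← integral_neg]
  congr 1 with x
  simp only [gaussKernel, neg_apply, smul_apply,
    innerSL_apply_apply, smul_eq_mul]
  field_simp

lemma continuous_kernelConv (μ : Measure E) [IsFiniteMeasure μ] {σ : ℝ} (hσ : 0 < σ) (v : E) :
    Continuous (kernelConv μ σ v) := by
  refine continuous_of_dominated (fun y => (integrable_gaussKernel_sub μ hσ v y).1)
    (fun y => Eventually.of_forall fun x => norm_gaussKernel_le hσ v _) (integrable_const _)
    (Eventually.of_forall fun x => ?_)
  exact (continuous_gaussKernel σ v).comp (by fun_prop)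

lemma continuous_fderiv_smoothed_apply (μ : Measure E) [IsFiniteMeasure μ] {σ : ℝ} (hσ : 0 < σ)
    (v : E) : Continuous fun y => fderiv ℝ (smoothed μ σ) y v := by
  have : (fun y => fderiv ℝ (smoothed μ σ) y v) = fun y => σ⁻¹ * -kernelConv μ σ v y := by
    ext y
    rw [← fderiv_smoothed_apply μ hσ]
    field_simp
  rw [this]
  exact (continuous_kernelConv μ hσ v).neg.const_mul _

lemma ofReal_smoothed (μ : Measure E) [IsFiniteMeasure μ] {σ : ℝ} (hσ : 0 < σ) (y : E) :
    ENNReal.ofReal (smoothed μ σ y) = ∫⁻ x, ENNReal.ofReal (gaussDensity σ (y - x)) ∂μ :=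
  ofReal_integral_eq_lintegral_ofReal (integrable_gaussDensity_sub μ hσ y)
    (Eventually.of_forall fun _ => (gaussDensity_pos hσ _).le)

/-- Integrating a product kernel `k (y - x)` over `y` decouples it from the law of `x`. -/
lemma lintegral_lintegral_sub (μ : Measure E) [SFinite μ] {k : E → ℝ≥0∞} (hk : Measurable k) :
    ∫⁻ y, ∫⁻ x, k (y - x) ∂μ = (∫⁻ z, k z) * μ univ := by
  rw [lintegral_lintegral_swap (by fun_prop)]
  simp_rw [lintegral_sub_right_eq_self]
  simp

/-- Jensen's inequality for the posterior law of the noise given the noisy observation: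
`m = kernelConv / smoothed` is its posterior mean along `v`. -/
lemma posterior_mean_pow_le (μ : Measure E) [IsFiniteMeasure μ] (hμ : μ ≠ 0) {σ : ℝ} (hσ : 0 < σ)
    (v y : E) (k : ℕ) (hk : ∀ m : ℝ, ∃ c : ℝ, ∀ h : ℝ, |m| ^ k + c * (h - m) ≤ |h| ^ k) :
    ENNReal.ofReal (|kernelConv μ σ v y / smoothed μ σ y| ^ k * smoothed μ σ y) ≤
      ∫⁻ x, ENNReal.ofReal (|⟪y - x, v⟫ / σ| ^ k) * ENNReal.ofReal (gaussDensity σ (y - x)) ∂μ := by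
  simp_rw [← ENNReal.ofReal_mul (pow_nonneg (abs_nonneg _) k)]
  have hG := continuous_gaussDensity (E := E) σ
  have hmeas : AEStronglyMeasurable
      (fun x => |⟪y - x, v⟫ / σ| ^ k * gaussDensity σ (y - x)) μ := by
    apply Continuous.aestronglyMeasurable; fun_prop
  have hnn : ∀ x, 0 ≤ |⟪y - x, v⟫ / σ| ^ k * gaussDensity σ (y - x) := fun x =>
    mul_nonneg (by positivity) (gaussDensity_pos hσ _).le
  by_cases hI : Integrable (fun x => |⟪y - x, v⟫ / σ| ^ k * gaussDensity σ (y - x)) μ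
  · rw [← ofReal_integral_eq_lintegral_ofReal hI (Eventually.of_forall hnn)]
    apply ENNReal.ofReal_le_ofReal
    have hq := smoothed_pos μ hμ hσ y
    set m := kernelConv μ σ v y / smoothed μ σ y with hm
    obtain ⟨c, hc⟩ := hk m
    have h1 := integrable_gaussDensity_sub μ hσ y
    have h2 := integrable_gaussKernel_sub μ hσ v y
    calc |m| ^ k * smoothed μ σ y
        = ∫ x, ((|m| ^ k - c * m) * gaussDensity σ (y - x) + c * gaussKernel σ v (y - x)) ∂μ := by
          rw [integral_add (h1.const_mul _) (h2.const_mul _), integral_const_mul,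
            integral_const_mul]
          change _ = (|m| ^ k - c * m) * smoothed μ σ y + c * kernelConv μ σ v y
          have : m * smoothed μ σ y = kernelConv μ σ v y := by rw [hm]; field_simp
          rw [← this]; ring
      _ ≤ _ := by
          refine integral_mono ((h1.const_mul _).add (h2.const_mul _)) hI fun x => ?_
          have := mul_le_mul_of_nonneg_right (hc (⟪y - x, v⟫ / σ)) (gaussDensity_pos hσ (y - x)).le
          simp only [gaussKernel]
          linarith
  · have : ∫⁻ x, ENNReal.ofReal (|⟪y - x, v⟫ / σ| ^ k * gaussDensity σ (y - x)) ∂μ = ⊤ := by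
      by_contra h
      exact hI ⟨hmeas, (hasFiniteIntegral_iff_ofReal (Eventually.of_forall hnn)).2
        (lt_top_iff_ne_top.2 h)⟩
    rw [this]; exact le_top

lemma exists_tangent_sq (m : ℝ) : ∃ c : ℝ, ∀ h : ℝ, |m| ^ 2 + c * (h - m) ≤ |h| ^ 2 :=
  ⟨2 * m, fun h => by rw [sq_abs, sq_abs]; nlinarith [sq_nonneg (h - m)]⟩

lemma exists_tangent_pow_four (m : ℝ) : ∃ c : ℝ, ∀ h : ℝ, |m| ^ 4 + c * (h - m) ≤ |h| ^ 4 :=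
  ⟨4 * m ^ 3, fun h => by
    rw [Even.pow_abs (by decide), Even.pow_abs (by decide)]
    have : 0 ≤ (h - m) ^ 2 * ((h + m) ^ 2 + 2 * m ^ 2) := by positivity
    nlinarith⟩

lemma lintegral_posterior_mean_pow_le (μ : Measure E) [IsFiniteMeasure μ] (hμ : μ ≠ 0) {σ : ℝ}
    (hσ : 0 < σ) (v : E) (k : ℕ)
    (hk : ∀ m : ℝ, ∃ c : ℝ, ∀ h : ℝ, |m| ^ k + c * (h - m) ≤ |h| ^ k) :
    ∫⁻ y, ENNReal.ofReal (|kernelConv μ σ v y / smoothed μ σ y| ^ k * smoothed μ σ y) ≤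
      (∫⁻ e, ENNReal.ofReal (|⟪e, v⟫| ^ k) ∂stdGaussian E) * μ univ := by
  refine (lintegral_mono fun y => posterior_mean_pow_le μ hμ hσ v y k hk).trans (le_of_eq ?_)
  have hG := (continuous_gaussDensity (E := E) σ).measurable
  rw [lintegral_lintegral_sub μ (k := fun z => ENNReal.ofReal (|⟪z, v⟫ / σ| ^ k) *
    ENNReal.ofReal (gaussDensity σ z)) (by fun_prop), lintegral_inner_pow_mul_gaussDensity hσ]

/-- The scaled Fisher information of `μ * N(0, σ² I)` in the direction `v`. -/
noncomputable def dirFisher (μ : Measure E) (σ : ℝ) (v : E) : ℝ≥0∞ :=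
  ∫⁻ y, ENNReal.ofReal (kernelConv μ σ v y ^ 2 / smoothed μ σ y)

lemma dirFisher_le (μ : Measure E) [IsFiniteMeasure μ] (hμ : μ ≠ 0) {σ : ℝ} (hσ : 0 < σ) (v : E) :
    dirFisher μ σ v ≤ ENNReal.ofReal (‖v‖ ^ 2) * μ univ := by
  have h := lintegral_posterior_mean_pow_le μ hμ hσ v 2 exists_tangent_sq
  simp_rw [sq_abs] at h
  rw [lintegral_inner_sq_stdGaussian] at h
  refine le_trans (le_of_eq ?_) h
  unfold dirFisher
  congr 1 with y
  have := smoothed_pos μ hμ hσ y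
  congr 1
  field_simp

/-- The Fisher information is controlled by the `L¹` norm of the derivative of the density, since
the posterior mean of the noise has bounded fourth moment: `m² ≤ A |m| + m⁴ / A²`. -/
lemma dirFisher_le_lintegral (μ : Measure E) [IsFiniteMeasure μ] (hμ : μ ≠ 0) {σ : ℝ} (hσ : 0 < σ)
    (v : E) (hv : ‖v‖ ≤ 1) {A : ℝ} (hA : 0 < A) :
    dirFisher μ σ v ≤ ENNReal.ofReal A * (∫⁻ y, ‖kernelConv μ σ v y‖ₑ) +
      ENNReal.ofReal (gaussFourthMoment E / A ^ 2) * μ univ := by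
  have h := (lintegral_posterior_mean_pow_le μ hμ hσ v 4 exists_tangent_pow_four).trans
    (mul_le_mul_left (lintegral_inner_pow_four_stdGaussian_le v hv) _)
  have hk := (continuous_kernelConv μ hσ v).measurable
  have hq := (differentiable_smoothed μ hσ).continuous.measurable
  have hpt : ∀ y, ENNReal.ofReal (kernelConv μ σ v y ^ 2 / smoothed μ σ y) ≤
      ENNReal.ofReal A * ‖kernelConv μ σ v y‖ₑ + ENNReal.ofReal (1 / A ^ 2) *
        ENNReal.ofReal (|kernelConv μ σ v y / smoothed μ σ y| ^ 4 * smoothed μ σ y) := by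
    intro y
    have hqy := smoothed_pos μ hμ hσ y
    rw [← ofReal_norm, ← ENNReal.ofReal_mul hA.le, ← ENNReal.ofReal_mul (by positivity),
      ← ENNReal.ofReal_add (by positivity) (by positivity), Real.norm_eq_abs]
    apply ENNReal.ofReal_le_ofReal
    set q := smoothed μ σ y
    obtain ⟨m, hm⟩ : ∃ m, kernelConv μ σ v y = m * q := ⟨kernelConv μ σ v y / q, by field_simp⟩
    rw [hm, mul_div_assoc, div_self hqy.ne', mul_one, abs_mul, abs_of_pos hqy]
    have key : |m| ^ 2 ≤ A * |m| + 1 / A ^ 2 * |m| ^ 4 := by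
      rcases le_total |m| A with hle | hle
      · have : 0 ≤ 1 / A ^ 2 * |m| ^ 4 := by positivity
        nlinarith [abs_nonneg m]
      · have h1 : 1 ≤ (|m| / A) ^ 2 := one_le_pow₀ ((one_le_div hA).2 hle)
        have h2 : 1 / A ^ 2 * |m| ^ 4 = (|m| / A) ^ 2 * |m| ^ 2 := by field_simp
        have h3 : 0 ≤ A * |m| := by positivity
        rw [h2]
        nlinarith [sq_nonneg |m|]
    have e : (m * q) ^ 2 / q = |m| ^ 2 * q := by rw [sq_abs]; field_simp
    rw [e]
    nlinarith
  refine (lintegral_mono hpt).trans ?_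
  rw [lintegral_add_left (by fun_prop), lintegral_const_mul _ (by fun_prop),
    lintegral_const_mul _ (by fun_prop)]
  refine add_le_add le_rfl ((mul_le_mul_right h _).trans (le_of_eq ?_))
  rw [← mul_assoc, ← ENNReal.ofReal_mul (by positivity)]
  congr 2
  ring

/-- Young's inequality for the kernels `gaussKernel σ (v a)` with a direction `v a` that varies with
the parameter. -/
lemma lintegral_enorm_integral_gaussKernel_le {α : Type*} [MeasurableSpace α] (m : Measure α)
    [SFinite m] {σ : ℝ} (hσ : 0 < σ) {F : α → ℝ} {v ψ : α → E} (hF : Measurable F)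
    (hv : Measurable v) (hψ : Measurable ψ) :
    ∫⁻ y, ‖∫ a, F a * gaussKernel σ (v a) (y - ψ a) ∂m‖ₑ ≤
      ∫⁻ a, ‖F a‖ₑ * ENNReal.ofReal ‖v a‖ ∂m := by
  have hG := (continuous_gaussDensity (E := E) σ).measurable
  calc _ ≤ ∫⁻ y, ∫⁻ a, ‖F a * gaussKernel σ (v a) (y - ψ a)‖ₑ ∂m :=
        lintegral_mono fun y => enorm_integral_le_lintegral_enorm _
    _ = ∫⁻ a, (∫⁻ y, ‖F a * gaussKernel σ (v a) (y - ψ a)‖ₑ) ∂m := by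
        refine lintegral_lintegral_swap ?_
        unfold gaussKernel
        fun_prop
    _ ≤ _ := by
        refine lintegral_mono fun a => ?_
        simp_rw [enorm_mul]
        rw [lintegral_const_mul' _ _ (by simp)]
        gcongr
        rw [lintegral_sub_right_eq_self (fun y => ‖gaussKernel σ (v a) y‖ₑ)]
        exact lintegral_enorm_gaussKernel_le hσ _

/-- The analogue of Young's inequality for the Gaussian density itself. -/
lemma lintegral_enorm_integral_gaussDensity_le {α : Type*} [MeasurableSpace α] (m : Measure α)
    [SFinite m] {σ : ℝ} (hσ : 0 < σ) {F : α → ℝ} {ψ : α → E} (hF : Measurable F)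
    (hψ : Measurable ψ) :
    ∫⁻ y, ‖∫ a, F a * gaussDensity σ (y - ψ a) ∂m‖ₑ ≤ ∫⁻ a, ‖F a‖ₑ ∂m := by
  have hG := (continuous_gaussDensity (E := E) σ).measurable
  calc _ ≤ ∫⁻ y, ∫⁻ a, ‖F a * gaussDensity σ (y - ψ a)‖ₑ ∂m :=
        lintegral_mono fun y => enorm_integral_le_lintegral_enorm _
    _ = ∫⁻ a, (∫⁻ y, ‖F a * gaussDensity σ (y - ψ a)‖ₑ) ∂m := by
        refine lintegral_lintegral_swap ?_
        fun_prop
    _ = _ := by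
        congr 1 with a
        simp_rw [enorm_mul]
        rw [lintegral_const_mul' _ _ (by simp),
          lintegral_sub_right_eq_self (fun y => ‖gaussDensity σ y‖ₑ)]
        have h := lintegral_mul_gaussDensity (E := E) hσ (F := fun _ => 1) measurable_const
        simp only [one_mul, lintegral_const, measure_univ] at h
        have e : ∀ z : E, ‖gaussDensity σ z‖ₑ = ENNReal.ofReal (gaussDensity σ z) := fun z => by
          rw [← ofReal_norm, Real.norm_eq_abs, abs_of_pos (gaussDensity_pos hσ z)]
        simp_rw [e, h, mul_one]

end Smoothed

lemma noised_eq_withDensity {n : ℕ} (μ : Measure (EuclideanSpace ℝ (Fin n))) [IsFiniteMeasure μ]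
    {σ : ℝ} (hσ : 0 < σ) :
    noised μ σ = volume.withDensity fun y => ENNReal.ofReal (smoothed μ σ y) := by
  have hG := (continuous_gaussDensity (E := EuclideanSpace ℝ (Fin n)) σ).measurable
  refine Measure.ext_of_lintegral _ fun f hf => ?_
  rw [noised, map_smul_stdGaussian hσ, Measure.lintegral_conv hf,
    lintegral_withDensity_eq_lintegral_mul _
      (differentiable_smoothed μ hσ).continuous.measurable.ennreal_ofReal hf]
  have h1 : ∀ x, ∫⁻ z, f (x + z) ∂(volume.withDensity fun z => ENNReal.ofReal (gaussDensity σ z)) =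
      ∫⁻ y, f y * ENNReal.ofReal (gaussDensity σ (y - x)) := by
    intro x
    rw [lintegral_withDensity_eq_lintegral_mul _ hG.ennreal_ofReal (by fun_prop),
      ← lintegral_sub_right_eq_self _ x]
    congr 1 with y
    simp [mul_comm]
  simp_rw [h1]
  rw [lintegral_lintegral_swap (by fun_prop)]
  congr 1 with y
  rw [lintegral_const_mul _ (by fun_prop), Pi.mul_apply, ofReal_smoothed μ hσ, mul_comm]

/-! ### The implicit score matching loss and the Fisher information -/

lemma hasFDerivAt_comp_toLp_apply {n : ℕ} {F : EuclideanSpace ℝ (Fin n) → EuclideanSpace ℝ (Fin n)}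
    (hF : Differentiable ℝ F) (i : Fin n) (x : Fin n → ℝ) :
    HasFDerivAt (fun x : Fin n → ℝ => F (WithLp.toLp 2 x) i)
      ((EuclideanSpace.proj i).comp ((fderiv ℝ F (WithLp.toLp 2 x)).comp
        (EuclideanSpace.equiv (Fin n) ℝ).symm.toContinuousLinearMap)) x := by
  have h1 : HasFDerivAt (fun x : Fin n → ℝ => (WithLp.toLp 2 x : EuclideanSpace ℝ (Fin n)))
      (EuclideanSpace.equiv (Fin n) ℝ).symm.toContinuousLinearMap x :=
    (EuclideanSpace.equiv (Fin n) ℝ).symm.hasFDerivAt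
  exact (EuclideanSpace.proj (𝕜 := ℝ) i).hasFDerivAt.comp x ((hF _).hasFDerivAt.comp x h1)

/-- The divergence theorem for compactly supported vector fields. The field need not be `C¹`: only
its divergence has to be integrable. -/
lemma integral_divergence_eq_zero {n : ℕ} {F : EuclideanSpace ℝ (Fin n) → EuclideanSpace ℝ (Fin n)}
    (hF : Differentiable ℝ F) (hc : HasCompactSupport F) (hi : Integrable (divergence F)) :
    ∫ y, divergence F y = 0 := by
  rcases n with _ | n
  · simp [divergence]
  obtain ⟨R, hR⟩ := hc.isBounded.subset_closedBall 0
  have hR0 : ∀ y : EuclideanSpace ℝ (Fin (n + 1)), |R| < ‖y‖ → y ∉ tsupport F := by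
    intro y hy hmem
    have := hR hmem
    rw [mem_closedBall_zero_iff] at this
    exact absurd (this.trans (le_abs_self R)) (not_le.2 hy)
  have hF0 : ∀ y : EuclideanSpace ℝ (Fin (n + 1)), |R| < ‖y‖ → F y = 0 := fun y hy =>
    image_eq_zero_of_notMem_tsupport (hR0 y hy)
  have hD0 : ∀ y : EuclideanSpace ℝ (Fin (n + 1)), |R| < ‖y‖ → divergence F y = 0 := by
    intro y hy
    have h : fderiv ℝ F y = 0 :=
      image_eq_zero_of_notMem_tsupport fun h => hR0 y hy (tsupport_fderiv_subset ℝ h)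
    simp [divergence, h]
  have hmp := PiLp.volume_preserving_toLp (Fin (n + 1))
  have hemb := (MeasurableEquiv.toLp 2 (Fin (n + 1) → ℝ)).measurableEmbedding
  rw [← hmp.integral_comp hemb]
  have hi' : Integrable (fun x : Fin (n + 1) → ℝ => divergence F (WithLp.toLp 2 x)) :=
    (hmp.integrable_comp_emb hemb).2 hi
  set a : Fin (n + 1) → ℝ := fun _ => -(|R| + 1) with ha
  set b : Fin (n + 1) → ℝ := fun _ => |R| + 1 with hb
  have hab : a ≤ b := fun i => by simp only [ha, hb]; linarith [abs_nonneg R]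
  have hcoord : ∀ (x : Fin (n + 1) → ℝ) (i), |x i| ≤ ‖(WithLp.toLp 2 x :
      EuclideanSpace ℝ (Fin (n + 1)))‖ := fun x i => by
    simpa using PiLp.norm_apply_le (WithLp.toLp 2 x : EuclideanSpace ℝ (Fin (n + 1))) i
  have hdiv : ∀ x : Fin (n + 1) → ℝ, divergence F (WithLp.toLp 2 x) =
      ∑ i, ((EuclideanSpace.proj (𝕜 := ℝ) i).comp ((fderiv ℝ F (WithLp.toLp 2 x)).comp
        (EuclideanSpace.equiv (Fin (n + 1)) ℝ).symm.toContinuousLinearMap)) (Pi.single i 1) := by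
    intro x
    rfl
  have hsub : ∫ x : Fin (n + 1) → ℝ, divergence F (WithLp.toLp 2 x) =
      ∫ x in Icc a b, divergence F (WithLp.toLp 2 x) := by
    rw [setIntegral_eq_integral_of_forall_compl_eq_zero]
    intro x hx
    apply hD0
    by_contra hle
    apply hx
    rw [not_lt] at hle
    have := fun i => abs_le.1 ((hcoord x i).trans hle)
    exact ⟨fun i => by simp only [ha]; linarith [(this i).1],
      fun i => by simp only [hb]; linarith [(this i).2]⟩
  rw [hsub]
  simp_rw [hdiv] at hi' ⊢
  rw [integral_divergence_of_hasFDerivAt_off_countable' a b hab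
    (fun i x => F (WithLp.toLp 2 x) i) _ ∅ countable_empty
    (fun i x _ => (hasFDerivAt_comp_toLp_apply hF i x).continuousAt.continuousWithinAt)
    (fun x _ i => hasFDerivAt_comp_toLp_apply hF i x) hi'.integrableOn]
  refine Finset.sum_eq_zero fun i _ => ?_
  have hface : ∀ c : ℝ, |R| < |c| → ∀ x : Fin n → ℝ,
      F (WithLp.toLp 2 (i.insertNth c x)) i = 0 := by
    intro c hc x
    rw [hF0 _ (hc.trans_le ?_)]
    · rfl
    · simpa using hcoord (i.insertNth c x) i
  have hpos : |R| < abs (|R| + 1) := (lt_add_one _).trans_le (le_abs_self _)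
  rw [integral_eq_zero_of_ae, integral_eq_zero_of_ae, sub_self]
  · exact Eventually.of_forall fun x => hface _ (by simpa only [ha, abs_neg] using hpos) x
  · exact Eventually.of_forall fun x => hface _ hpos x

lemma divergence_smul {n : ℕ} {ρ : EuclideanSpace ℝ (Fin n) → ℝ}
    {s : EuclideanSpace ℝ (Fin n) → EuclideanSpace ℝ (Fin n)} (hρ : Differentiable ℝ ρ)
    (hs : Differentiable ℝ s) (y : EuclideanSpace ℝ (Fin n)) :
    divergence (fun y => ρ y • s y) y = ρ y * divergence s y + fderiv ℝ ρ y (s y) := by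
  unfold divergence
  rw [fderiv_fun_smul (hρ y) (hs y)]
  have h : s y = ∑ i, s y i • EuclideanSpace.single i (1 : ℝ) := by
    simpa using ((EuclideanSpace.basisFun (Fin n) ℝ).sum_repr (s y)).symm
  conv_rhs => rw [h, map_sum]
  rw [Finset.mul_sum, ← Finset.sum_add_distrib]
  refine Finset.sum_congr rfl fun i _ => ?_
  simp [mul_comm]

/-- Young's inequality behind the lower bound of the loss, with a cutoff of size `f` and
slope `e`. -/
lemma cutoff_young {q a e t f η : ℝ} (hq : 0 < q) (ha : 0 ≤ a) (ht : 0 ≤ t)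
    (hf : 0 ≤ f) (hf1 : f ≤ 1) (hη : 0 < η) :
    f ^ 2 * (a * t) + 2 * f * q * (e * t) ≤
      f ^ 2 * q * (t ^ 2 / 2) + (1 + η) / 2 * (a ^ 2 / q) + 2 * (1 + 1 / η) * (e ^ 2 * q) := by
  have h1 : f ^ 2 * (a * t) ≤ f * (a * t) := by
    have : 0 ≤ f * (a * t) := by positivity
    nlinarith
  have h2 : 0 ≤ (f * q * t - (a + 2 * q * e)) ^ 2 / (2 * q) := by positivity
  have h3 : (f * q * t - (a + 2 * q * e)) ^ 2 / (2 * q) =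
      f ^ 2 * q * (t ^ 2 / 2) - (f * (a * t) + 2 * f * q * (e * t)) +
        (a + 2 * q * e) ^ 2 / (2 * q) := by
    field_simp; ring
  have h4 : 0 ≤ (η * a - 2 * q * e) ^ 2 / (2 * q * η) := by positivity
  have h5 : (η * a - 2 * q * e) ^ 2 / (2 * q * η) =
      (1 + η) / 2 * (a ^ 2 / q) + 2 * (1 + 1 / η) * (e ^ 2 * q) -
        (a + 2 * q * e) ^ 2 / (2 * q) := by
    field_simp; ring
  linarith

/-- A sequence of cutoff functions exhausting the space with slopes `O (1 / k)`. -/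
lemma exists_cutoff (E : Type*) [NormedAddCommGroup E] [InnerProductSpace ℝ E]
    [FiniteDimensional ℝ E] : ∃ (C : ℝ) (φ : ℕ → E → ℝ), 0 ≤ C ∧ ∀ k : ℕ, ContDiff ℝ 1 (φ k) ∧
      HasCompactSupport (φ k) ∧ (∀ y, 0 ≤ φ k y ∧ φ k y ≤ 1) ∧
      (∀ y, ‖fderiv ℝ (φ k) y‖ ≤ C * (k + 1 : ℝ)⁻¹) ∧ (∀ y, ‖y‖ ≤ k → φ k y = 1) := by
  let f : ContDiffBump (0 : E) := ⟨1, 2, one_pos, one_lt_two⟩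
  have hf : ContDiff ℝ 1 (f : E → ℝ) := f.contDiff
  obtain ⟨C, hC⟩ := (hf.continuous_fderiv one_ne_zero).bounded_above_of_compact_support
    (f.hasCompactSupport.fderiv ℝ)
  refine ⟨C, fun k y => f ((k + 1 : ℝ)⁻¹ • y), (norm_nonneg _).trans (hC 0),
    fun k => ⟨?_, ?_, ?_, ?_, ?_⟩⟩
  · exact hf.comp (contDiff_const_smul _)
  · exact f.hasCompactSupport.comp_smul (by positivity)
  · exact fun y => ⟨f.nonneg, f.le_one⟩
  · intro y
    have h := fderiv_comp_smul (𝕜 := ℝ) (f := (f : E → ℝ)) (x := y) ((k + 1 : ℝ)⁻¹)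
    rw [h, norm_smul, Real.norm_eq_abs, abs_of_pos (by positivity), mul_comm]
    gcongr
    exact hC _
  · intro y hy
    apply f.one_of_mem_closedBall
    rw [mem_closedBall_zero_iff, norm_smul, Real.norm_eq_abs, abs_of_pos (by positivity)]
    change _ ≤ (1 : ℝ)
    rw [inv_mul_le_iff₀ (by positivity)]
    linarith

section ISM

variable {n : ℕ}

local notation "𝔼" => EuclideanSpace ℝ (Fin n)

lemma contDiff_smoothed (μ : Measure 𝔼) [IsFiniteMeasure μ] {σ : ℝ} (hσ : 0 < σ) :
    ContDiff ℝ 1 (smoothed μ σ) := by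
  rw [contDiff_one_iff_fderiv]
  exact ⟨differentiable_smoothed μ hσ,
    continuous_clm_apply.2 fun v => continuous_fderiv_smoothed_apply μ hσ v⟩

lemma sum_kernelConv_sq {ι : Type*} [Fintype ι] (b : OrthonormalBasis ι ℝ 𝔼) (μ : Measure 𝔼)
    [IsFiniteMeasure μ] {σ : ℝ} (hσ : 0 < σ) (y : 𝔼) :
    ∑ i, kernelConv μ σ (b i) y ^ 2 = σ ^ 2 * ‖fderiv ℝ (smoothed μ σ) y‖ ^ 2 := by
  rw [b.norm_dual, Finset.mul_sum]
  refine Finset.sum_congr rfl fun i _ => ?_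
  rw [← neg_sq, ← fderiv_smoothed_apply μ hσ, mul_pow]

lemma integrable_smoothed (μ : Measure 𝔼) [IsFiniteMeasure μ] {σ : ℝ} (hσ : 0 < σ) :
    Integrable (smoothed μ σ) := by
  refine ⟨(contDiff_smoothed μ hσ).continuous.aestronglyMeasurable, ?_⟩
  rw [hasFiniteIntegral_iff_ofReal (Eventually.of_forall fun y => smoothed_nonneg μ hσ y)]
  simp_rw [ofReal_smoothed μ hσ]
  rw [lintegral_lintegral_sub μ (k := fun z => ENNReal.ofReal (gaussDensity σ z))
    (continuous_gaussDensity σ).measurable.ennreal_ofReal]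
  refine ENNReal.mul_lt_top ?_ (measure_lt_top _ _)
  exact (hasFiniteIntegral_iff_ofReal (Eventually.of_forall fun y => (gaussDensity_pos hσ y).le)).1
    (integrable_gaussDensity hσ).2

lemma integrable_kernelConv_sq_div (μ : Measure 𝔼) [IsFiniteMeasure μ] (hμ : μ ≠ 0) {σ : ℝ}
    (hσ : 0 < σ) (v : 𝔼) : Integrable (fun y => kernelConv μ σ v y ^ 2 / smoothed μ σ y) := by
  refine ⟨?_, ?_⟩
  · exact (((continuous_kernelConv μ hσ v).pow 2).div (contDiff_smoothed μ hσ).continuous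
      fun y => (smoothed_pos μ hμ hσ y).ne').aestronglyMeasurable
  · rw [hasFiniteIntegral_iff_ofReal (Eventually.of_forall fun y =>
      div_nonneg (sq_nonneg _) (smoothed_nonneg μ hσ y))]
    exact (dirFisher_le μ hμ hσ v).trans_lt (ENNReal.mul_lt_top (by simp) (measure_lt_top _ _))

/-- The expected loss is at least minus half the scaled Fisher information of the noised law. The
proof integrates `∇ · (φ² q s)` for cutoffs `φ` of slope `O (1 / k)`, and then lets `k → ∞` with
Young parameter `1 / (k + 1)`. Note that `∇ · s` and `‖s‖²` need not be integrable separately. -/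
theorem neg_half_fisher_le_integral_ismLoss {ι : Type*} [Fintype ι] (b : OrthonormalBasis ι ℝ 𝔼)
    (μ : Measure 𝔼) [IsFiniteMeasure μ] (hμ : μ ≠ 0) {σ : ℝ} (hσ : 0 < σ)
    {s : 𝔼 → 𝔼} (hs : Differentiable ℝ s) (hint : Integrable (ismLoss σ s) (noised μ σ)) :
    -(1 / 2) * ∑ i, (dirFisher μ σ (b i)).toReal ≤ ∫ x, ismLoss σ s x ∂(noised μ σ) := by
  have hqd := contDiff_smoothed μ hσ
  have hqc := hqd.continuous
  have hq := smoothed_pos μ hμ hσ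
  set q := smoothed μ σ with hqdef
  have hmq : Measurable fun y => ENNReal.ofReal (q y) := hqc.measurable.ennreal_ofReal
  rw [noised_eq_withDensity μ hσ] at hint ⊢
  rw [integrable_withDensity_iff_integrable_smul' hmq (by simp)] at hint
  rw [integral_withDensity_eq_integral_toReal_smul hmq (by simp)]
  simp only [ENNReal.toReal_ofReal (hq _).le, smul_eq_mul] at hint ⊢
  have hI : ∀ i, (dirFisher μ σ (b i)).toReal = ∫ y, kernelConv μ σ (b i) y ^ 2 / q y := fun i => by
    rw [integral_eq_lintegral_of_nonneg_ae (Eventually.of_forall fun y =>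
      div_nonneg (sq_nonneg _) (hq y).le) (integrable_kernelConv_sq_div μ hμ hσ (b i)).1, dirFisher]
  simp_rw [hI]
  have hIi : Integrable (fun y => ∑ i, kernelConv μ σ (b i) y ^ 2 / q y) :=
    integrable_finsetSum _ fun i _ => integrable_kernelConv_sq_div μ hμ hσ (b i)
  have hsum : ∀ y, ∑ i, kernelConv μ σ (b i) y ^ 2 / q y = σ ^ 2 * (‖fderiv ℝ q y‖ ^ 2 / q y) := by
    intro y
    rw [← Finset.sum_div, sum_kernelConv_sq b μ hσ, mul_div_assoc]
  have hsumI : ∑ i, ∫ y, kernelConv μ σ (b i) y ^ 2 / q y =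
      ∫ y, σ ^ 2 * (‖fderiv ℝ q y‖ ^ 2 / q y) := by
    simp_rw [← hsum]
    exact (integral_finsetSum _ fun i _ => integrable_kernelConv_sq_div μ hμ hσ (b i)).symm
  rw [hsumI]
  simp_rw [hsum] at hIi
  obtain ⟨C, φ, hC, hφ⟩ := exists_cutoff 𝔼
  -- the lower bound for the loss integrated against the cutoff
  have hk : ∀ k : ℕ, -((1 + (k + 1 : ℝ)⁻¹) / 2) * (∫ y, σ ^ 2 * (‖fderiv ℝ q y‖ ^ 2 / q y)) -
      2 * σ ^ 2 * C ^ 2 * ((1 + (k + 1 : ℝ)) * ((k + 1 : ℝ)⁻¹) ^ 2) * (∫ y, q y) ≤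
      ∫ y, φ k y ^ 2 * (q y * ismLoss σ s y) := by
    intro k
    obtain ⟨h1, h2, h3, h4, -⟩ := hφ k
    have hρ : ContDiff ℝ 1 (fun y => φ k y ^ 2 * q y) := (h1.pow 2).mul hqd
    have hρs : HasCompactSupport (fun y => φ k y ^ 2 * q y) := by
      refine HasCompactSupport.mul_right ?_
      simp_rw [pow_two]
      exact h2.mul_right
    have hρd := hρ.differentiable one_ne_zero
    have hsc := hs.continuous
    have i1 : Integrable (fun y => φ k y ^ 2 * (q y * ismLoss σ s y)) := by
      refine hint.bdd_mul (c := 1) (h1.continuous.pow 2).aestronglyMeasurable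
        (Eventually.of_forall fun y => ?_)
      rw [norm_pow, Real.norm_eq_abs, abs_of_nonneg (h3 y).1]
      exact pow_le_one₀ (h3 y).1 (h3 y).2
    have i2 : Integrable (fun y => (φ k y ^ 2 * q y) * (‖s y‖ ^ 2 / 2)) :=
      Continuous.integrable_of_hasCompactSupport (by fun_prop) hρs.mul_right
    have i3 : Integrable (fun y => fderiv ℝ (fun y => φ k y ^ 2 * q y) y (s y)) := by
      refine Continuous.integrable_of_hasCompactSupport
        ((hρ.continuous_fderiv one_ne_zero).clm_apply hsc) ?_
      exact (hρs.fderiv ℝ).mono' fun y hy => subset_tsupport _ fun h => hy (by simp [h])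
    have hdiv : ∀ y, divergence (fun y => (φ k y ^ 2 * q y) • s y) y =
        (σ ^ 2)⁻¹ * (φ k y ^ 2 * (q y * ismLoss σ s y)) - (φ k y ^ 2 * q y) * (‖s y‖ ^ 2 / 2) +
          fderiv ℝ (fun y => φ k y ^ 2 * q y) y (s y) := by
      intro y
      rw [divergence_smul hρd hs, ismLoss]
      field_simp
      ring
    have i4 : Integrable (divergence fun y => (φ k y ^ 2 * q y) • s y) :=
      (((i1.const_mul _).sub i2).add i3).congr (Eventually.of_forall fun y => (hdiv y).symm)
    have h0 : ∫ y, divergence (fun y => (φ k y ^ 2 * q y) • s y) y = 0 :=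
      integral_divergence_eq_zero (hρd.smul hs) hρs.smul_right i4
    have hq1 : Integrable (fun y => q y) := integrable_smoothed μ hσ
    have heq : ∫ y, φ k y ^ 2 * (q y * ismLoss σ s y) =
        ∫ y, (φ k y ^ 2 * (q y * ismLoss σ s y) -
          σ ^ 2 * divergence (fun y => (φ k y ^ 2 * q y) • s y) y) := by
      rw [integral_sub i1 (i4.const_mul _), integral_const_mul, h0, mul_zero, sub_zero]
    rw [heq, ← integral_const_mul, ← integral_const_mul, ← integral_sub (hIi.const_mul _)
      (hq1.const_mul _)]
    refine integral_mono ((hIi.const_mul _).sub (hq1.const_mul _)) (i1.sub (i4.const_mul _))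
      fun y => ?_
    have hfd : fderiv ℝ (fun y => φ k y ^ 2 * q y) y (s y) =
        φ k y ^ 2 * fderiv ℝ q y (s y) + 2 * φ k y * q y * fderiv ℝ (φ k) y (s y) := by
      have hA := ((h1.differentiable one_ne_zero y).hasFDerivAt.pow 2).mul
        (hqd.differentiable one_ne_zero y).hasFDerivAt
      rw [show (fun y => φ k y ^ 2 * q y) = ((fun y => φ k y ^ 2) * q) from rfl, hA.fderiv]
      simp
      ring
    have hη : (0 : ℝ) < (k + 1 : ℝ)⁻¹ := by positivity
    have hy := cutoff_young (hq y) (norm_nonneg (fderiv ℝ q y)) (e := ‖fderiv ℝ (φ k) y‖)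
      (norm_nonneg (s y)) (h3 y).1 (h3 y).2 hη
    have e1 := (abs_le.1 ((Real.norm_eq_abs _).symm.le.trans ((fderiv ℝ q y).le_opNorm (s y)))).2
    have e2 := (abs_le.1 ((Real.norm_eq_abs _).symm.le.trans
      ((fderiv ℝ (φ k) y).le_opNorm (s y)))).2
    have e3 := mul_le_mul_of_nonneg_left e1 (sq_nonneg (φ k y))
    have e4 := mul_le_mul_of_nonneg_left e2
      (mul_nonneg (mul_nonneg zero_le_two (h3 y).1) (hq y).le)
    have e5 : ‖fderiv ℝ (φ k) y‖ ^ 2 * q y ≤ (C * (k + 1 : ℝ)⁻¹) ^ 2 * q y :=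
      mul_le_mul_of_nonneg_right (pow_le_pow_left₀ (norm_nonneg _) (h4 y) 2) (hq y).le
    have e6 := mul_le_mul_of_nonneg_left e5 (by positivity : 0 ≤ 2 * (1 + 1 / (k + 1 : ℝ)⁻¹))
    have hσ2 : 0 < σ ^ 2 := by positivity
    have e7 : σ ^ 2 * (fderiv ℝ (fun y => φ k y ^ 2 * q y) y (s y) -
        (φ k y ^ 2 * q y) * (‖s y‖ ^ 2 / 2)) ≤
        σ ^ 2 * ((1 + (k + 1 : ℝ)⁻¹) / 2 * (‖fderiv ℝ q y‖ ^ 2 / q y) +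
          2 * (1 + 1 / (k + 1 : ℝ)⁻¹) * ((C * (k + 1 : ℝ)⁻¹) ^ 2 * q y)) := by
      refine mul_le_mul_of_nonneg_left ?_ hσ2.le
      rw [hfd]
      linarith
    simp only [hdiv y]
    have e8 : σ ^ 2 * ((σ ^ 2)⁻¹ * (φ k y ^ 2 * (q y * ismLoss σ s y))) =
      φ k y ^ 2 * (q y * ismLoss σ s y) := by field_simp
    have e9 : (1 / (k + 1 : ℝ)⁻¹) = k + 1 := by simp
    rw [e9] at e7
    rw [mul_add, mul_sub, e8]
    nlinarith [e7]
  have hlim1 : Tendsto (fun k : ℕ => ∫ y, φ k y ^ 2 * (q y * ismLoss σ s y)) atTop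
      (𝓝 (∫ y, q y * ismLoss σ s y)) := by
    refine tendsto_integral_of_dominated_convergence (fun y => ‖q y * ismLoss σ s y‖)
      (fun k => ((hφ k).1.continuous.pow 2).aestronglyMeasurable.mul hint.1) hint.norm
      (fun k => Eventually.of_forall fun y => ?_) (Eventually.of_forall fun y => ?_)
    · rw [norm_mul, norm_pow, Real.norm_eq_abs (φ k y), abs_of_nonneg ((hφ k).2.2.1 y).1]
      exact mul_le_of_le_one_left (norm_nonneg _)
        (pow_le_one₀ ((hφ k).2.2.1 y).1 ((hφ k).2.2.1 y).2)
    · refine tendsto_const_nhds.congr' ?_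
      filter_upwards [eventually_ge_atTop ⌈‖y‖⌉₊] with k hk'
      rw [(hφ k).2.2.2.2 y ((Nat.le_ceil _).trans (by exact_mod_cast hk')), one_pow, one_mul]
  have ht : Tendsto (fun k : ℕ => (k + 1 : ℝ)⁻¹) atTop (𝓝 0) := by
    simpa using tendsto_one_div_add_atTop_nhds_zero_nat (𝕜 := ℝ)
  have ht2 : Tendsto (fun k : ℕ => (1 + (k + 1 : ℝ)) * ((k + 1 : ℝ)⁻¹) ^ 2) atTop (𝓝 0) := by
    have : (fun k : ℕ => (1 + (k + 1 : ℝ)) * ((k + 1 : ℝ)⁻¹) ^ 2) =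
        fun k : ℕ => ((k + 1 : ℝ)⁻¹) ^ 2 + (k + 1 : ℝ)⁻¹ := by
      ext k; field_simp
    rw [this]
    simpa using (ht.pow 2).add ht
  refine le_of_tendsto_of_tendsto' ?_ hlim1 hk
  have := ((((ht.const_add 1).div_const 2).neg.mul_const
    (∫ y, σ ^ 2 * (‖fderiv ℝ q y‖ ^ 2 / q y))).sub
      ((ht2.const_mul (2 * σ ^ 2 * C ^ 2)).mul_const (∫ y, q y)))
  simpa using this

end ISM

/-! ### Derivatives of smoothed measures on a patch -/

section Patch

variable {F : Type*} [NormedAddCommGroup F] [InnerProductSpace ℝ F] [FiniteDimensional ℝ F]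
  [MeasurableSpace F] [BorelSpace F]

open scoped Manifold in
/-- A smooth Urysohn function for a compact subset of an open set. -/
lemma exists_contDiff_one_on_compact {K B : Set F} (hK : IsCompact K) (hB : IsOpen B)
    (hKB : K ⊆ B) :
    ∃ χ : F → ℝ, ContDiff ℝ 1 χ ∧ tsupport χ ⊆ B ∧ (∀ x ∈ K, χ x = 1) ∧
      ∀ x, 0 ≤ χ x ∧ χ x ≤ 1 := by
  obtain ⟨f, h0, h1, h01⟩ := exists_contMDiffMap_zero_one_nhds_of_isClosed (n := 1) 𝓘(ℝ, F)
    hB.isClosed_compl hK.isClosed (disjoint_compl_left.mono_right hKB)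
  refine ⟨f, f.contMDiff.contDiff, ?_, fun x hx => h1.self_of_nhdsSet x hx, h01⟩
  intro x hx
  by_contra hxB
  have : ∀ᶠ y in 𝓝 x, f y = 0 := eventually_nhdsSet_iff_forall.1 h0 x hxB
  exact (notMem_tsupport_iff_eventuallyEq.2 this) hx

/-- The Lebesgue density of a finite measure carried by an open set `B` is approximated in
`L¹` by `C¹` functions with compact support in `B`. -/
lemma exists_contDiff_approx_rnDeriv (ν : Measure F) [IsFiniteMeasure ν]
    {B : Set F} (hB : IsOpen B) (hνB : ν Bᶜ = 0) {ε : ℝ} (hε : 0 < ε) :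
    ∃ g : F → ℝ, ContDiff ℝ 1 g ∧ HasCompactSupport g ∧ tsupport g ⊆ B ∧
      ∫⁻ u, ‖(ν.rnDeriv volume u).toReal - g u‖ₑ ≤ ENNReal.ofReal ε := by
  have hε2 : 0 < ε / 2 := by positivity
  obtain ⟨K, hKB, hK, hνK⟩ := hB.measurableSet.exists_isCompact_sdiff_lt (measure_ne_top ν B)
    (ENNReal.ofReal_pos.2 hε2).ne'
  have hνKc : ν Kᶜ ≤ ENNReal.ofReal (ε / 2) := by
    refine (measure_mono (t := (B \ K) ∪ Bᶜ) fun x hx => ?_).trans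
      ((measure_union_le _ _).trans (by rw [hνB, add_zero]; exact hνK.le))
    by_cases h : x ∈ B
    · exact Or.inl ⟨h, hx⟩
    · exact Or.inr h
  obtain ⟨χ, hχ, hχB, hχ1, hχ01⟩ := exists_contDiff_one_on_compact hK hB hKB
  set f : F → ℝ := fun u => (ν.rnDeriv volume u).toReal with hf
  have hfi : Integrable f := Measure.integrable_toReal_rnDeriv
  obtain ⟨g, hgc, hg, hfg⟩ := (memLp_one_iff_integrable.2 hfi).exist_eLpNorm_sub_le
    (by norm_num) le_rfl hε2
  have hfm : Measurable f := (Measure.measurable_rnDeriv _ _).ennreal_toReal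
  rw [eLpNorm_one_eq_lintegral_enorm] at hfg
  refine ⟨fun u => χ u * g u, hχ.mul (hg.of_le (by norm_cast)), hgc.mul_left,
    (tsupport_mul_subset_left (f := χ) (g := g)).trans hχB, ?_⟩
  have hpt : ∀ u, ‖f u - χ u * g u‖ₑ ≤ Kᶜ.indicator (fun u => ‖f u‖ₑ) u + ‖(f - g) u‖ₑ := by
    intro u
    have e : f u - χ u * g u = (1 - χ u) * f u + χ u * (f - g) u := by
      simp only [Pi.sub_apply]; ring
    rw [e]
    refine (enorm_add_le _ _).trans (add_le_add ?_ ?_)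
    · by_cases hu : u ∈ K
      · simp [hχ1 u hu]
      · rw [indicator_of_mem hu, enorm_mul]
        refine mul_le_of_le_one_left (zero_le) ?_
        rw [← ofReal_norm, Real.norm_eq_abs, abs_of_nonneg (by linarith [(hχ01 u).2])]
        exact ENNReal.ofReal_le_one.2 (by linarith [(hχ01 u).1])
    · rw [enorm_mul]
      refine mul_le_of_le_one_left (zero_le) ?_
      rw [← ofReal_norm, Real.norm_eq_abs, abs_of_nonneg (hχ01 u).1]
      exact ENNReal.ofReal_le_one.2 (hχ01 u).2
  refine (lintegral_mono hpt).trans ?_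
  have hgm : Measurable g := hg.continuous.measurable
  rw [lintegral_add_left (hfm.enorm.indicator hK.measurableSet.compl),
    lintegral_indicator hK.measurableSet.compl]
  have hfK : ∫⁻ u in Kᶜ, ‖f u‖ₑ ≤ ν Kᶜ := by
    refine (lintegral_mono fun u => ?_).trans (Measure.setLIntegral_rnDeriv_le (ν := volume) Kᶜ)
    rw [← ofReal_norm, Real.norm_eq_abs, abs_of_nonneg ENNReal.toReal_nonneg]
    exact ENNReal.ofReal_toReal_le
  calc _ ≤ ENNReal.ofReal (ε / 2) + ENNReal.ofReal (ε / 2) :=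
        add_le_add (hfK.trans hνKc) hfg
    _ = ENNReal.ofReal ε := by rw [← ENNReal.ofReal_add hε2.le hε2.le, add_halves]

variable {E : Type*} [NormedAddCommGroup E] [InnerProductSpace ℝ E] [FiniteDimensional ℝ E]
  [MeasurableSpace E] [BorelSpace E]

/-- Differentiating the Gaussian density along a tangent vector of a patch is the same as
differentiating in the parameter of the patch, and the latter derivative can be moved to the
weight `g`. -/
lemma integral_mul_gaussKernel_fderiv {B : Set F} (hB : IsOpen B) {ψ : F → E} (hψm : Measurable ψ)
    (hψ : DifferentiableOn ℝ ψ B) {g : F → ℝ} (hg : ContDiff ℝ 1 g) (hgc : HasCompactSupport g)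
    (hgB : tsupport g ⊆ B) {σ : ℝ} (hσ : 0 < σ) (w : F) (y : E)
    (hint : Integrable fun u => g u * gaussKernel σ (fderiv ℝ ψ u w) (y - ψ u)) :
    ∫ u, g u * gaussKernel σ (fderiv ℝ ψ u w) (y - ψ u) =
      ∫ u, -(σ * fderiv ℝ g u w) * gaussDensity σ (y - ψ u) := by
  have hGd : ∀ u ∈ B, HasFDerivAt (fun u => gaussDensity σ (y - ψ u))
      ((-((gaussDensity σ (y - ψ u) / σ ^ 2) • innerSL ℝ (y - ψ u))).comp (-fderiv ℝ ψ u)) u := by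
    intro u hu
    exact (hasFDerivAt_gaussDensity hσ (y - ψ u)).comp u
      (((hψ u hu).differentiableAt (hB.mem_nhds hu)).hasFDerivAt.const_sub y)
  have hGe : ∀ u ∈ B, fderiv ℝ (fun u => gaussDensity σ (y - ψ u)) u w =
      σ⁻¹ * gaussKernel σ (fderiv ℝ ψ u w) (y - ψ u) := by
    intro u hu
    rw [(hGd u hu).fderiv]
    simp only [gaussKernel, ContinuousLinearMap.comp_apply, neg_apply, smul_apply,
      innerSL_apply_apply, smul_eq_mul, inner_neg_right]
    field_simp
  have hgG : ∀ u, g u * fderiv ℝ (fun u => gaussDensity σ (y - ψ u)) u w =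
      σ⁻¹ * (g u * gaussKernel σ (fderiv ℝ ψ u w) (y - ψ u)) := by
    intro u
    by_cases hu : u ∈ tsupport g
    · rw [hGe u (hgB hu)]; ring
    · rw [image_eq_zero_of_notMem_tsupport hu]; simp
  have hGm : Measurable fun u => gaussDensity σ (y - ψ u) :=
    (continuous_gaussDensity σ).measurable.comp (hψm.const_sub y)
  have hGb : ∀ᵐ u : F, ‖gaussDensity σ (y - ψ u)‖ ≤ gaussDensity σ (0 : E) :=
    Eventually.of_forall fun u => by
      rw [Real.norm_eq_abs, abs_of_pos (gaussDensity_pos hσ _)]; exact gaussDensity_le hσ _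
  have i1 : Integrable fun u => fderiv ℝ g u w * gaussDensity σ (y - ψ u) := by
    refine Integrable.mul_bdd (c := gaussDensity σ (0 : E)) ?_ hGm.aestronglyMeasurable hGb
    refine Continuous.integrable_of_hasCompactSupport
      ((hg.continuous_fderiv one_ne_zero).clm_apply continuous_const) ?_
    exact (hgc.fderiv ℝ).mono' fun u hu => subset_tsupport _ fun h => hu (by simp [h])
  have i2 : Integrable fun u => g u * gaussDensity σ (y - ψ u) :=
    Integrable.mul_bdd (c := gaussDensity σ (0 : E))
      (hg.continuous.integrable_of_hasCompactSupport hgc) hGm.aestronglyMeasurable hGb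
  have key := integral_mul_fderiv_eq_neg_fderiv_mul_of_integrable (v := w) i1
    (by simp_rw [hgG]; exact hint.const_mul _) i2
    (fun u _ => (hg.differentiable one_ne_zero) u)
    (fun u hu => (hGd u (hgB hu)).differentiableAt)
  simp_rw [hgG] at key
  rw [integral_const_mul] at key
  have : ∀ u, -(σ * fderiv ℝ g u w) * gaussDensity σ (y - ψ u) =
      -σ * (fderiv ℝ g u w * gaussDensity σ (y - ψ u)) := fun u => by ring
  simp_rw [this]
  rw [integral_const_mul, neg_mul, ← mul_neg, ← key]
  field_simp

/-- The noised law of an absolutely continuous measure on a patch `ψ` is asymptotically flat in a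
direction `b` that is tangent to the patch up to an error `η`. -/
lemma eventually_lintegral_kernelConv_map_le (ν : Measure F) [IsFiniteMeasure ν] (hν : ν ≪ volume)
    {B : Set F} (hB : IsOpen B) (hνB : ν Bᶜ = 0) {ψ : F → E} (hψm : Measurable ψ)
    (hψ : DifferentiableOn ℝ ψ B) (w : F) (b : E) {η : ℝ} (hη : 0 ≤ η)
    (hηB : ∀ u ∈ B, ‖b - fderiv ℝ ψ u w‖ ≤ η) {δ : ℝ} (hδ : 0 < δ) :
    ∀ᶠ σ in 𝓝[>] (0 : ℝ),
      ∫⁻ y, ‖kernelConv (ν.map ψ) σ b y‖ₑ ≤ ENNReal.ofReal η * ν univ + ENNReal.ofReal δ := by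
  have hε : 0 < δ / 2 / (‖b‖ + η + 1) := by positivity
  set ε := δ / 2 / (‖b‖ + η + 1) with hεdef
  obtain ⟨g, hg, hgc, hgB, hfg⟩ := exists_contDiff_approx_rnDeriv ν hB hνB hε
  set f : F → ℝ := fun u => (ν.rnDeriv volume u).toReal with hf
  have hfi : Integrable f := Measure.integrable_toReal_rnDeriv
  have hfm : Measurable f := (Measure.measurable_rnDeriv _ _).ennreal_toReal
  have hgm : Measurable g := hg.continuous.measurable
  have hfgm : Measurable fun u => f u - g u := hfm.sub hgm
  have hgi : Integrable g := hg.continuous.integrable_of_hasCompactSupport hgc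
  have hDi : Integrable fun u => fderiv ℝ g u w := by
    refine Continuous.integrable_of_hasCompactSupport
      ((hg.continuous_fderiv one_ne_zero).clm_apply continuous_const) ?_
    exact (hgc.fderiv ℝ).mono' fun u hu => subset_tsupport _ fun h => hu (by simp [h])
  have hDm : Measurable fun u => fderiv ℝ g u w := measurable_fderiv_apply_const ℝ g w
  have hψ'm : Measurable fun u => fderiv ℝ ψ u w := measurable_fderiv_apply_const ℝ ψ w
  have hf1 : ∫⁻ u, ‖f u‖ₑ ≤ ν univ := by
    refine (lintegral_mono fun u => ?_).trans
      ((setLIntegral_univ _).symm.le.trans (Measure.setLIntegral_rnDeriv_le (ν := volume) univ))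
    rw [← ofReal_norm, Real.norm_eq_abs, abs_of_nonneg ENNReal.toReal_nonneg]
    exact ENNReal.ofReal_toReal_le
  have hg1 : ∫⁻ u, ‖g u‖ₑ ≤ ν univ + ENNReal.ofReal ε := by
    calc ∫⁻ u, ‖g u‖ₑ ≤ ∫⁻ u, (‖f u‖ₑ + ‖f u - g u‖ₑ) := by
          refine lintegral_mono fun u => ?_
          have : g u = f u - (f u - g u) := by ring
          conv_lhs => rw [this]
          exact enorm_sub_le
      _ = (∫⁻ u, ‖f u‖ₑ) + ∫⁻ u, ‖f u - g u‖ₑ := lintegral_add_left hfm.enorm _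
      _ ≤ _ := add_le_add hf1 hfg
  set D := ∫ u, ‖fderiv ℝ g u w‖ with hD
  have hD0 : 0 ≤ D := integral_nonneg fun _ => norm_nonneg _
  filter_upwards [Ioo_mem_nhdsGT (show (0 : ℝ) < δ / 2 / (D + 1) by positivity)] with σ ⟨hσ, hσ₀⟩
  -- the three contributions: approximation of the density, tilt of the patch, slope of the weight
  have hsplit : ∀ y, kernelConv (ν.map ψ) σ b y =
      (∫ u, (f u - g u) * gaussKernel σ b (y - ψ u)) +
      (∫ u, g u * gaussKernel σ (b - fderiv ℝ ψ u w) (y - ψ u)) +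
      ∫ u, -(σ * fderiv ℝ g u w) * gaussDensity σ (y - ψ u) := by
    intro y
    have hGm : Measurable fun u => gaussDensity σ (y - ψ u) :=
      (continuous_gaussDensity σ).measurable.comp (hψm.const_sub y)
    have hkm : AEStronglyMeasurable (fun u => gaussKernel σ b (y - ψ u)) :=
      ((continuous_gaussKernel σ b).measurable.comp (hψm.const_sub y)).aestronglyMeasurable
    have hkb : ∀ᵐ u : F, ‖gaussKernel σ b (y - ψ u)‖ ≤ ‖b‖ * gaussDensity σ (0 : E) :=
      Eventually.of_forall fun u => norm_gaussKernel_le hσ _ _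
    have j1 : Integrable fun u => (f u - g u) * gaussKernel σ b (y - ψ u) :=
      (hfi.sub hgi).mul_bdd hkm hkb
    have j2 : Integrable fun u => g u * gaussKernel σ b (y - ψ u) := hgi.mul_bdd hkm hkb
    have j3 : Integrable fun u => g u * gaussKernel σ (b - fderiv ℝ ψ u w) (y - ψ u) := by
      refine Integrable.mono' (hgi.norm.mul_const (η * gaussDensity σ (0 : E))) ?_
        (Eventually.of_forall fun u => ?_)
      · apply Measurable.aestronglyMeasurable
        unfold gaussKernel
        fun_prop
      · rw [norm_mul]
        by_cases hu : u ∈ tsupport g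
        · refine mul_le_mul_of_nonneg_left ((norm_gaussKernel_le hσ _ _).trans ?_) (norm_nonneg _)
          exact mul_le_mul_of_nonneg_right (hηB u (hgB hu)) (gaussDensity_pos hσ _).le
        · rw [image_eq_zero_of_notMem_tsupport hu]; simp
    have hlin : ∀ u, g u * gaussKernel σ b (y - ψ u) -
        g u * gaussKernel σ (b - fderiv ℝ ψ u w) (y - ψ u) =
        g u * gaussKernel σ (fderiv ℝ ψ u w) (y - ψ u) := by
      intro u
      simp only [gaussKernel, inner_sub_right]
      ring
    have j4 : Integrable fun u => g u * gaussKernel σ (fderiv ℝ ψ u w) (y - ψ u) :=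
      (j2.sub j3).congr (Eventually.of_forall hlin)
    have j13 : Integrable fun u => (f u - g u) * gaussKernel σ b (y - ψ u) +
        g u * gaussKernel σ (b - fderiv ℝ ψ u w) (y - ψ u) := j1.add j3
    rw [← integral_mul_gaussKernel_fderiv hB hψm hψ hg hgc hgB hσ w y j4, ← integral_add j1 j3,
      ← integral_add j13 j4, kernelConv, integral_map hψm.aemeasurable
        (integrable_gaussKernel_sub (ν.map ψ) hσ b y).1,
      ← integral_rnDeriv_smul hν]
    congr 1 with u
    have := hlin u
    simp only [smul_eq_mul]
    change f u * _ = _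
    linarith
  simp_rw [hsplit]
  have b1 := lintegral_enorm_integral_gaussKernel_le (volume : Measure F) hσ
    (F := fun u => f u - g u) (v := fun _ => b) hfgm measurable_const hψm
  have b2 := lintegral_enorm_integral_gaussKernel_le (volume : Measure F) hσ
    (F := g) (v := fun u => b - fderiv ℝ ψ u w) hgm (hψ'm.const_sub b) hψm
  have b3 := lintegral_enorm_integral_gaussDensity_le (E := E) (volume : Measure F) hσ
    (F := fun u => -(σ * fderiv ℝ g u w)) (hDm.const_mul σ).neg hψm
  have b1' : ∫⁻ u, ‖f u - g u‖ₑ * ENNReal.ofReal ‖b‖ ≤ ENNReal.ofReal (ε * ‖b‖) := by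
    rw [lintegral_mul_const _ hfgm.enorm, ENNReal.ofReal_mul hε.le]
    gcongr
  have b2' : ∫⁻ u, ‖g u‖ₑ * ENNReal.ofReal ‖b - fderiv ℝ ψ u w‖ ≤
      ENNReal.ofReal η * ν univ + ENNReal.ofReal (ε * η) := by
    calc _ ≤ ∫⁻ u, ‖g u‖ₑ * ENNReal.ofReal η := by
          refine lintegral_mono fun u => ?_
          by_cases hu : u ∈ tsupport g
          · exact mul_le_mul_right (ENNReal.ofReal_le_ofReal (hηB u (hgB hu))) _
          · simp [image_eq_zero_of_notMem_tsupport hu]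
      _ ≤ (ν univ + ENNReal.ofReal ε) * ENNReal.ofReal η := by
          rw [lintegral_mul_const _ hgm.enorm]; gcongr
      _ = _ := by rw [add_mul, ENNReal.ofReal_mul hε.le, mul_comm]
  have b3' : ∫⁻ u, ‖-(σ * fderiv ℝ g u w)‖ₑ ≤ ENNReal.ofReal (σ * D) := by
    simp_rw [enorm_neg, enorm_mul]
    rw [lintegral_const_mul _ hDm.enorm, ENNReal.ofReal_mul hσ.le, hD,
      ofReal_integral_norm_eq_lintegral_enorm hDi, Real.enorm_eq_ofReal hσ.le]
  have hKm : ∀ {v : F → E} {h : F → ℝ}, Measurable v → Measurable h →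
      Measurable fun y => ∫ u, h u * gaussKernel σ (v u) (y - ψ u) := by
    intro v h hv hh
    have hG := (continuous_gaussDensity (E := E) σ).measurable
    refine (StronglyMeasurable.integral_prod_right'
      (f := fun p : E × F => h p.2 * gaussKernel σ (v p.2) (p.1 - ψ p.2)) ?_).measurable
    apply Measurable.stronglyMeasurable
    unfold gaussKernel
    fun_prop
  have m1 : Measurable fun y => ∫ u, (f u - g u) * gaussKernel σ b (y - ψ u) :=
    hKm (v := fun _ => b) measurable_const hfgm
  have m2 := hKm (v := fun u => b - fderiv ℝ ψ u w) (h := g) (hψ'm.const_sub b) hgm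
  have m12 : Measurable fun y => ‖∫ u, (f u - g u) * gaussKernel σ b (y - ψ u)‖ₑ +
      ‖∫ u, g u * gaussKernel σ (b - fderiv ℝ ψ u w) (y - ψ u)‖ₑ := m1.enorm.add m2.enorm
  have hsmall : ε * ‖b‖ + ε * η ≤ δ / 2 := by
    have : ε * (‖b‖ + η + 1) = δ / 2 := by rw [hεdef]; field_simp
    nlinarith
  have hsmall2 : σ * D ≤ δ / 2 := by
    have h := (lt_div_iff₀ (by positivity)).1 hσ₀
    nlinarith
  calc _ ≤ ∫⁻ y, (‖∫ u, (f u - g u) * gaussKernel σ b (y - ψ u)‖ₑ +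
        ‖∫ u, g u * gaussKernel σ (b - fderiv ℝ ψ u w) (y - ψ u)‖ₑ +
        ‖∫ u, -(σ * fderiv ℝ g u w) * gaussDensity σ (y - ψ u)‖ₑ) :=
        lintegral_mono fun y => (enorm_add_le _ _).trans (by gcongr; exact enorm_add_le _ _)
    _ ≤ ENNReal.ofReal (ε * ‖b‖) + (ENNReal.ofReal η * ν univ + ENNReal.ofReal (ε * η)) +
        ENNReal.ofReal (σ * D) := by
        rw [lintegral_add_left m12, lintegral_add_left m1.enorm]
        exact add_le_add (add_le_add (b1.trans b1') (b2.trans b2')) (b3.trans b3')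
    _ = ENNReal.ofReal η * ν univ + ENNReal.ofReal (ε * ‖b‖ + ε * η + σ * D) := by
        rw [ENNReal.ofReal_add (by positivity) (by positivity),
          ENNReal.ofReal_add (by positivity) (by positivity)]
        ring
    _ ≤ _ := by
        gcongr
        linarith

end Patch

/-! ### Flat patches of a submanifold -/

section Chart

variable {n d : ℕ}

/-- The inclusion of `ℝᵈ` into `ℝⁿ` as the subspace of the first `d` coordinates. -/
noncomputable def coordInclusion (n d : ℕ) :
    EuclideanSpace ℝ (Fin d) →L[ℝ] EuclideanSpace ℝ (Fin n) :=
  (EuclideanSpace.equiv (Fin n) ℝ).symm.toContinuousLinearMap.comp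
    (ContinuousLinearMap.pi fun i : Fin n =>
      if h : (i : ℕ) < d then EuclideanSpace.proj ⟨i, h⟩ else 0)

/-- The projection of `ℝⁿ` onto the first `d` coordinates. -/
noncomputable def coordProj (hd : d ≤ n) :
    EuclideanSpace ℝ (Fin n) →L[ℝ] EuclideanSpace ℝ (Fin d) :=
  (EuclideanSpace.equiv (Fin d) ℝ).symm.toContinuousLinearMap.comp
    (ContinuousLinearMap.pi fun j : Fin d => EuclideanSpace.proj (Fin.castLE hd j))

lemma coordInclusion_apply_of_lt (u : EuclideanSpace ℝ (Fin d)) (i : Fin n) (h : (i : ℕ) < d) :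
    coordInclusion n d u i = u ⟨i, h⟩ := by
  simp [coordInclusion, h]

lemma coordInclusion_apply_of_le (u : EuclideanSpace ℝ (Fin d)) (i : Fin n) (h : d ≤ (i : ℕ)) :
    coordInclusion n d u i = 0 := by
  simp [coordInclusion, not_lt.2 h]

lemma coordProj_coordInclusion (hd : d ≤ n) (u : EuclideanSpace ℝ (Fin d)) :
    coordProj hd (coordInclusion n d u) = u := by
  ext j
  have : coordProj hd (coordInclusion n d u) j = coordInclusion n d u (Fin.castLE hd j) := rfl
  rw [this, coordInclusion_apply_of_lt _ _ (by simp)]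
  rfl

lemma coordInclusion_coordProj (hd : d ≤ n) {y : EuclideanSpace ℝ (Fin n)}
    (hy : ∀ i : Fin n, d ≤ (i : ℕ) → y i = 0) : coordInclusion n d (coordProj hd y) = y := by
  ext i
  by_cases h : (i : ℕ) < d
  · rw [coordInclusion_apply_of_lt _ _ h]
    rfl
  · rw [coordInclusion_apply_of_le _ _ (not_lt.1 h), hy i (not_lt.1 h)]

/-- The range of an injective linear map is spanned by the first vectors of an orthonormal basis. -/
lemma exists_orthonormalBasis_adapted (hd : d ≤ n)
    (L : EuclideanSpace ℝ (Fin d) →L[ℝ] EuclideanSpace ℝ (Fin n)) (hL : Function.Injective L) :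
    ∃ (b : OrthonormalBasis (Fin n) ℝ (EuclideanSpace ℝ (Fin n)))
      (w : Fin d → EuclideanSpace ℝ (Fin d)), ∀ j, L (w j) = b (Fin.castLE hd j) := by
  have hrank : finrank ℝ (LinearMap.range L.toLinearMap) = d := by
    rw [LinearMap.finrank_range_of_inj hL, finrank_euclideanSpace_fin]
  let e := (stdOrthonormalBasis ℝ (LinearMap.range L.toLinearMap)).reindex (finCongr hrank)
  let v : Fin n → EuclideanSpace ℝ (Fin n) := fun i =>
    if h : (i : ℕ) < d then (e ⟨i, h⟩ : EuclideanSpace ℝ (Fin n)) else 0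
  have he : Orthonormal ℝ fun j => (e j : EuclideanSpace ℝ (Fin n)) :=
    e.orthonormal.comp_linearIsometry (LinearMap.range L.toLinearMap).subtypeₗᵢ
  have hv : Orthonormal ℝ ({i : Fin n | (i : ℕ) < d}.domRestrict v) := by
    have h := he.comp (fun i : {i : Fin n | (i : ℕ) < d} => (⟨i.1, i.2⟩ : Fin d))
      (fun i j hij => by
        apply Subtype.ext; apply Fin.ext
        simpa using hij)
    convert! h using 1
    ext1 i
    have hi : ((i : Fin n) : ℕ) < d := i.2
    simp [v, hi]
  obtain ⟨b, hb⟩ := Orthonormal.exists_orthonormalBasis_extension_of_card_eq (by simp) hv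
  have hw : ∀ j : Fin d, ∃ w, L w = b (Fin.castLE hd j) := by
    intro j
    obtain ⟨w, hw⟩ := (e j).2
    refine ⟨w, ?_⟩
    rw [hb _ (by simp : (Fin.castLE hd j) ∈ {i : Fin n | (i : ℕ) < d})]
    simpa [v] using hw
  choose w hw using hw
  exact ⟨b, w, hw⟩

/-- Around each of its points, a submanifold is parametrized by a Lipschitz patch whose tangent
spaces are almost constant. -/
lemma exists_flat_patch (hd : d ≤ n) {M : Set (EuclideanSpace ℝ (Fin n))}
    (hM : IsEmbeddedSubmanifold d M) {x : EuclideanSpace ℝ (Fin n)} (hx : x ∈ M) {η : ℝ}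
    (hη : 0 < η) :
    ∃ (b : OrthonormalBasis (Fin n) ℝ (EuclideanSpace ℝ (Fin n)))
      (w : Fin d → EuclideanSpace ℝ (Fin d)) (V : Set (EuclideanSpace ℝ (Fin n)))
      (B : Set (EuclideanSpace ℝ (Fin d)))
      (ψ : EuclideanSpace ℝ (Fin d) → EuclideanSpace ℝ (Fin n))
      (χ : EuclideanSpace ℝ (Fin n) → EuclideanSpace ℝ (Fin d)),
      IsOpen V ∧ x ∈ V ∧ IsOpen B ∧ Measurable ψ ∧ Measurable χ ∧ DifferentiableOn ℝ ψ B ∧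
      (∃ C, LipschitzOnWith C ψ B) ∧
      (∀ j, ∀ u ∈ B, ‖b (Fin.castLE hd j) - fderiv ℝ ψ u (w j)‖ ≤ η) ∧
      ∀ y ∈ V, y ∈ M → χ y ∈ B ∧ ψ (χ y) = y := by
  obtain ⟨Φ, hxΦ, hΦ, hΦ', hΦM⟩ := hM x hx
  set ι := coordInclusion n d
  set P := coordProj hd
  have hιP : ∀ y ∈ Φ.source, y ∈ M → ι (P (Φ y)) = Φ y := fun y hy hyM =>
    coordInclusion_coordProj hd ((hΦM y hy).1 hyM)
  set u₀ := P (Φ x)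
  have hu₀ : ι u₀ = Φ x := hιP x hxΦ hx
  set B₀ := ι ⁻¹' Φ.target
  have hB₀ : IsOpen B₀ := Φ.open_target.preimage ι.continuous
  have hu₀B : u₀ ∈ B₀ := by
    change ι u₀ ∈ Φ.target
    rw [hu₀]; exact Φ.map_source hxΦ
  let ψ₀ : EuclideanSpace ℝ (Fin d) → EuclideanSpace ℝ (Fin n) := fun u => Φ.symm (ι u)
  have hψ₀ : ContDiffOn ℝ 1 ψ₀ B₀ := hΦ'.comp ι.contDiff.contDiffOn fun u hu => hu
  have hψ₀at : ∀ u ∈ B₀, ContDiffAt ℝ 1 ψ₀ u := fun u hu => hψ₀.contDiffAt (hB₀.mem_nhds hu)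
  have hψ₀x : ψ₀ u₀ = x := by
    change Φ.symm (ι u₀) = x
    rw [hu₀, Φ.left_inv hxΦ]
  set L := fderiv ℝ ψ₀ u₀ with hLdef
  have hL : Function.Injective L := by
    have h1 : HasFDerivAt ψ₀ L u₀ :=
      ((hψ₀at u₀ hu₀B).differentiableAt one_ne_zero).hasFDerivAt
    have h2 : HasFDerivAt Φ (fderiv ℝ Φ x) (ψ₀ u₀) := by
      rw [hψ₀x]
      exact ((hΦ.contDiffAt (Φ.open_source.mem_nhds hxΦ)).differentiableAt one_ne_zero).hasFDerivAt
    have h3 : HasFDerivAt (fun u => P (Φ (ψ₀ u))) (P.comp ((fderiv ℝ Φ x).comp L)) u₀ :=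
      P.hasFDerivAt.comp u₀ (h2.comp u₀ h1)
    have h4 : HasFDerivAt (fun u => P (Φ (ψ₀ u))) (ContinuousLinearMap.id ℝ _) u₀ := by
      refine (hasFDerivAt_id u₀).congr_of_eventuallyEq ?_
      filter_upwards [hB₀.mem_nhds hu₀B] with u hu
      change P (Φ (Φ.symm (ι u))) = u
      rw [Φ.right_inv hu]
      exact coordProj_coordInclusion hd u
    have h5 := h3.unique h4
    intro a c hac
    have ha := congrArg (fun T => T a) h5
    have hc := congrArg (fun T => T c) h5
    simp only [ContinuousLinearMap.comp_apply, ContinuousLinearMap.id_apply] at ha hc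
    rw [← ha, ← hc, hac]
  obtain ⟨b, w, hbw⟩ := exists_orthonormalBasis_adapted hd L hL
  obtain ⟨C, t, ht, hCt⟩ := (hψ₀at u₀ hu₀B).exists_lipschitzOnWith
  have hflat : ∀ᶠ u in 𝓝 u₀, ∀ j, ‖b (Fin.castLE hd j) - fderiv ℝ ψ₀ u (w j)‖ < η := by
    rw [eventually_all]
    intro j
    have hcont : ContinuousAt (fun u => ‖b (Fin.castLE hd j) - fderiv ℝ ψ₀ u (w j)‖) u₀ := by
      have := (hψ₀.continuousOn_fderiv_of_isOpen hB₀ le_rfl).continuousAt (hB₀.mem_nhds hu₀B)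
      exact (continuousAt_const.sub (this.clm_apply continuousAt_const)).norm
    refine hcont.eventually_lt continuousAt_const ?_
    simpa [← hLdef, hbw j] using hη
  obtain ⟨B, hBsub, hB, hu₀B'⟩ := mem_nhds_iff.1
    (inter_mem (inter_mem (hB₀.mem_nhds hu₀B) ht) hflat)
  classical
  let ψ : EuclideanSpace ℝ (Fin d) → EuclideanSpace ℝ (Fin n) := B.piecewise ψ₀ fun _ => 0
  have hψB : EqOn ψ ψ₀ B := B.piecewise_eqOn _ _
  have hψe : ∀ u ∈ B, ψ =ᶠ[𝓝 u] ψ₀ := fun u hu => hψB.eventuallyEq_of_mem (hB.mem_nhds hu)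
  have hPΦ : ContinuousOn (fun y => P (Φ y)) Φ.source :=
    P.continuous.comp_continuousOn Φ.continuousOn
  let V := Φ.source ∩ (fun y => P (Φ y)) ⁻¹' B
  have hV : IsOpen V := hPΦ.isOpen_inter_preimage Φ.open_source hB
  let χ : EuclideanSpace ℝ (Fin n) → EuclideanSpace ℝ (Fin d) :=
    V.piecewise (fun y => P (Φ y)) fun _ => 0
  refine ⟨b, w, V, B, ψ, χ, hV, ⟨hxΦ, hu₀B'⟩, hB, ?_, ?_, ?_, ⟨C, ?_⟩, ?_, ?_⟩
  · exact (hψ₀.continuousOn.mono fun u hu => (hBsub hu).1.1).measurable_piecewise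
      continuousOn_const hB.measurableSet
  · exact (hPΦ.mono inter_subset_left).measurable_piecewise continuousOn_const hV.measurableSet
  · exact (DifferentiableOn.congr (fun u hu => ((hψ₀at u (hBsub hu).1.1).differentiableAt
      one_ne_zero).differentiableWithinAt) hψB)
  · intro u hu v hv
    rw [hψB hu, hψB hv]
    exact hCt (hBsub hu).1.2 (hBsub hv).1.2
  · intro j u hu
    rw [(hψe u hu).fderiv_eq]
    exact ((hBsub hu).2 j).le
  · intro y hy hyM
    have h1 : χ y = P (Φ y) := V.piecewise_eq_of_mem _ _ hy
    refine ⟨h1 ▸ hy.2, ?_⟩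
    rw [h1, hψB hy.2]
    change Φ.symm (ι (P (Φ y))) = y
    rw [hιP y hy.1 hyM, Φ.left_inv hy.1]

end Chart

lemma euclideanHausdorffMeasure_image_eq_zero {n d : ℕ} {C : NNReal}
    {ψ : EuclideanSpace ℝ (Fin d) → EuclideanSpace ℝ (Fin n)} {A : Set (EuclideanSpace ℝ (Fin d))}
    (hψ : LipschitzOnWith C ψ A) (hA : volume A = 0) :
    Measure.euclideanHausdorffMeasure d (ψ '' A) = 0 := by
  have hc := Measure.addHaarScalarFactor_volume_hausdorffMeasure_ne_zero d
  rw [← EuclideanSpace.euclideanHausdorffMeasure_eq_volume, Measure.euclideanHausdorffMeasure_def,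
    Measure.smul_apply, ENNReal.smul_def, smul_eq_mul, mul_eq_zero] at hA
  have hA' := hA.resolve_left (by simpa using hc)
  have h := hψ.hausdorffMeasure_image_le (d := d) (by positivity)
  rw [hA', mul_zero, nonpos_iff_eq_zero] at h
  rw [Measure.euclideanHausdorffMeasure_def, Measure.smul_apply, h, smul_zero]

/-! ### Lower bounds for the expected loss -/

section Bound

variable {n d : ℕ}

local notation "𝔼" => EuclideanSpace ℝ (Fin n)

/-- For all small `σ > 0`, uniformly in the field `s`, the expected loss under `μ * N(0, σ² I)` is
at least `-c` per unit of mass of `μ`. -/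
def EventuallyLossGe (μ : Measure 𝔼) (c : ℝ) : Prop :=
  ∀ᶠ σ in 𝓝[>] (0 : ℝ), ∀ s : 𝔼 → 𝔼, Differentiable ℝ s →
    Integrable (ismLoss σ s) (noised μ σ) →
    -c * μ.real univ ≤ ∫ x, ismLoss σ s x ∂(noised μ σ)

lemma noised_zero (σ : ℝ) : noised (0 : Measure 𝔼) σ = 0 := Measure.zero_conv _

lemma noised_add (μ ν : Measure 𝔼) [IsFiniteMeasure μ] [IsFiniteMeasure ν] (σ : ℝ) :
    noised (μ + ν) σ = noised μ σ + noised ν σ := by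
  have : IsProbabilityMeasure ((stdGaussian 𝔼).map fun e => σ • e) :=
    Measure.isProbabilityMeasure_map (by fun_prop)
  exact Measure.add_conv _ _ _

lemma integral_ismLoss_noised_add {μ ν : Measure 𝔼} [IsFiniteMeasure μ] [IsFiniteMeasure ν] {σ : ℝ}
    {s : 𝔼 → 𝔼} (h : Integrable (ismLoss σ s) (noised (μ + ν) σ)) :
    Integrable (ismLoss σ s) (noised μ σ) ∧ Integrable (ismLoss σ s) (noised ν σ) ∧
      ∫ x, ismLoss σ s x ∂(noised (μ + ν) σ) =
        (∫ x, ismLoss σ s x ∂(noised μ σ)) + ∫ x, ismLoss σ s x ∂(noised ν σ) := by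
  rw [noised_add] at h ⊢
  obtain ⟨h1, h2⟩ := integrable_add_measure.1 h
  exact ⟨h1, h2, integral_add_measure h1 h2⟩

lemma EventuallyLossGe.zero (c : ℝ) : EventuallyLossGe (0 : Measure 𝔼) c :=
  Eventually.of_forall fun σ s _ _ => by simp [noised_zero]

lemma EventuallyLossGe.add {μ ν : Measure 𝔼} [IsFiniteMeasure μ] [IsFiniteMeasure ν] {c : ℝ}
    (hμ : EventuallyLossGe μ c) (hν : EventuallyLossGe ν c) : EventuallyLossGe (μ + ν) c := by
  filter_upwards [hμ, hν] with σ h1 h2 s hs hint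
  obtain ⟨i1, i2, e⟩ := integral_ismLoss_noised_add hint
  rw [e, measureReal_add_apply, mul_add]
  exact add_le_add (h1 s hs i1) (h2 s hs i2)

/-- The crude bound, valid for every `σ`: the posterior mean of the noise has second moment at
most `n`. -/
lemma neg_half_dim_le_integral_ismLoss (μ : Measure 𝔼) [IsFiniteMeasure μ] {σ : ℝ} (hσ : 0 < σ)
    {s : 𝔼 → 𝔼} (hs : Differentiable ℝ s) (hint : Integrable (ismLoss σ s) (noised μ σ)) :
    -((n : ℝ) / 2) * μ.real univ ≤ ∫ x, ismLoss σ s x ∂(noised μ σ) := by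
  rcases eq_or_ne μ 0 with rfl | hμ
  · simp [noised_zero]
  refine le_trans ?_ (neg_half_fisher_le_integral_ismLoss (EuclideanSpace.basisFun (Fin n) ℝ)
    μ hμ hσ hs hint)
  have h : ∀ i : Fin n, (dirFisher μ σ (EuclideanSpace.basisFun (Fin n) ℝ i)).toReal ≤
      μ.real univ := by
    intro i
    have := dirFisher_le μ hμ hσ (EuclideanSpace.basisFun (Fin n) ℝ i)
    rw [(EuclideanSpace.basisFun (Fin n) ℝ).orthonormal.1 i, one_pow, ENNReal.ofReal_one,
      one_mul] at this
    exact ENNReal.toReal_mono (measure_ne_top _ _) this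
  have h2 := Finset.sum_le_sum fun i (_ : i ∈ Finset.univ) => h i
  simp only [Finset.sum_const, Finset.card_univ, Fintype.card_fin, nsmul_eq_mul] at h2
  linarith

/-- If each of `d` orthonormal directions eventually contributes at most `ε` per unit of mass to the
scaled Fisher information, then the others, contributing at most `1` each, give the constant. -/
lemma eventuallyLossGe_of_dirFisher (hd : d ≤ n) {μ : Measure 𝔼} [IsFiniteMeasure μ] (hμ : μ ≠ 0)
    (b : OrthonormalBasis (Fin n) ℝ 𝔼) {ε : ℝ}
    (h : ∀ j : Fin d, ∀ᶠ σ in 𝓝[>] (0 : ℝ),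
      dirFisher μ σ (b (Fin.castLE hd j)) ≤ ENNReal.ofReal ε * μ univ) (hε : 0 ≤ ε) :
    EventuallyLossGe μ (((n : ℝ) - d) / 2 + d * ε / 2) := by
  filter_upwards [eventually_all.2 h, self_mem_nhdsWithin] with σ hj hσ s hs hint
  refine le_trans ?_ (neg_half_fisher_le_integral_ismLoss b μ hμ hσ hs hint)
  have hle : ∀ i : Fin n, (dirFisher μ σ (b i)).toReal ≤
      if (i : ℕ) < d then ε * μ.real univ else μ.real univ := by
    intro i
    split_ifs with hi
    · have := ENNReal.toReal_mono (by finiteness) (hj ⟨i, hi⟩)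
      rwa [ENNReal.toReal_mul, ENNReal.toReal_ofReal hε] at this
    · have := dirFisher_le μ hμ hσ (b i)
      rw [b.orthonormal.1 i, one_pow, ENNReal.ofReal_one, one_mul] at this
      exact ENNReal.toReal_mono (measure_ne_top _ _) this
  have hsum := Finset.sum_le_sum fun i (_ : i ∈ Finset.univ) => hle i
  have hcard : (Finset.univ.filter fun i : Fin n => (i : ℕ) < d).card = d := by
    simp [Fin.card_filter_val_lt, hd]
  have hcard2 : (((Finset.univ.filter fun i : Fin n => ¬ (i : ℕ) < d).card : ℕ) : ℝ) = n - d := by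
    have := Finset.card_filter_add_card_filter_not (s := (Finset.univ : Finset (Fin n)))
      (fun i : Fin n => (i : ℕ) < d)
    rw [hcard, Finset.card_univ, Fintype.card_fin] at this
    rw [eq_sub_iff_add_eq, add_comm]
    exact_mod_cast this
  rw [Finset.sum_ite, Finset.sum_const, Finset.sum_const, nsmul_eq_mul, nsmul_eq_mul, hcard,
    hcard2] at hsum
  linarith

/-- The sharp bound, up to `δ`, for measures carried by a small piece of the submanifold. How small
the piece must be depends on `δ` but not on the measure. -/
lemma exists_nhds_eventuallyLossGe (hd : d ≤ n) {M : Set 𝔼} (hM : IsEmbeddedSubmanifold d M)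
    {δ : ℝ} (hδ : 0 < δ) {x : 𝔼} (hx : x ∈ M) :
    ∃ V : Set 𝔼, IsOpen V ∧ x ∈ V ∧ ∀ μ : Measure 𝔼, IsFiniteMeasure μ →
      μ ≪ (Measure.euclideanHausdorffMeasure d).restrict M → μ Vᶜ = 0 →
      EventuallyLossGe μ (((n : ℝ) - d) / 2 + δ) := by
  -- each of the `d` tangent directions is allowed to contribute `3 * ε`
  have hε : 0 < 2 * δ / (3 * (d + 1)) := by positivity
  set ε := 2 * δ / (3 * (d + 1)) with hεdef
  have hC := gaussFourthMoment_nonneg (E := 𝔼)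
  -- the level `A` in `dirFisher_le_lintegral`, large enough for its fourth moment term
  set A := gaussFourthMoment 𝔼 / ε + 1 with hAdef
  have hA1 : 1 ≤ A := by
    have : 0 ≤ gaussFourthMoment 𝔼 / ε := by positivity
    linarith
  have hA : 0 < A := by linarith
  have hCA : gaussFourthMoment 𝔼 / A ^ 2 ≤ ε := by
    rw [div_le_iff₀ (by positivity)]
    have h1 : gaussFourthMoment 𝔼 = ε * (A - 1) := by rw [hAdef]; field_simp; ring
    rw [h1]
    refine mul_le_mul_of_nonneg_left ?_ hε.le
    nlinarith
  obtain ⟨b, w, V, B, ψ, χ, hV, hxV, hB, hψm, hχm, hψ, ⟨C, hψC⟩, hflat, hchart⟩ :=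
    exists_flat_patch hd hM hx (η := ε / A) (by positivity)
  refine ⟨V, hV, hxV, fun μ hμfin hμM hμV => ?_⟩
  rcases eq_or_ne μ 0 with rfl | hμ
  · exact EventuallyLossGe.zero _
  -- `μ` is carried by `M ∩ V` and vanishes on sets of Hausdorff measure zero
  have hnull : ∀ S : Set 𝔼, MeasurableSet S →
      Measure.euclideanHausdorffMeasure d (S ∩ V ∩ M) = 0 → μ S = 0 := by
    intro S hS h0
    have h1 : μ (S ∩ V) = 0 :=
      hμM (by rwa [Measure.restrict_apply (hS.inter hV.measurableSet)])
    refine measure_mono_null (t := (S ∩ V) ∪ Vᶜ) (fun y hy => ?_) (measure_union_null h1 hμV)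
    by_cases h : y ∈ V
    · exact Or.inl ⟨hy, h⟩
    · exact Or.inr h
  have hνac : μ.map χ ≪ volume := by
    refine Measure.AbsolutelyContinuous.mk fun S hS hS0 => ?_
    rw [Measure.map_apply hχm hS]
    refine hnull _ (hχm hS) (measure_mono_null (t := ψ '' (S ∩ B)) ?_ ?_)
    · rintro y ⟨⟨hyS, hyV⟩, hyM⟩
      exact ⟨χ y, ⟨hyS, (hchart y hyV hyM).1⟩, (hchart y hyV hyM).2⟩
    · exact euclideanHausdorffMeasure_image_eq_zero (hψC.mono inter_subset_right)
        (measure_mono_null inter_subset_left hS0)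
  have hνB : μ.map χ Bᶜ = 0 := by
    rw [Measure.map_apply hχm hB.measurableSet.compl]
    refine hnull _ (hχm hB.measurableSet.compl) (measure_mono_null (t := ∅) ?_ measure_empty)
    rintro y ⟨⟨h1, h2⟩, h3⟩
    exact h1 (hchart y h2 h3).1
  have hmap : (μ.map χ).map ψ = μ := by
    rw [Measure.map_map hψm hχm]
    have : ψ ∘ χ =ᵐ[μ] id := by
      refine hnull _ (measurableSet_eq_fun (hψm.comp hχm) measurable_id).compl
        (measure_mono_null (t := ∅) ?_ measure_empty)
      rintro y ⟨⟨h1, h2⟩, h3⟩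
      exact h1 (hchart y h2 h3).2
    rw [Measure.map_congr this, Measure.map_id]
  have hmass : μ.map χ univ = μ univ := by rw [Measure.map_apply hχm .univ, preimage_univ]
  have hmpos : 0 < μ.real univ := by
    rw [measureReal_def]
    exact ENNReal.toReal_pos (Measure.measure_univ_ne_zero.2 hμ) (measure_ne_top _ _)
  have htan : ∀ j : Fin d, ∀ᶠ σ in 𝓝[>] (0 : ℝ),
      dirFisher μ σ (b (Fin.castLE hd j)) ≤ ENNReal.ofReal (3 * ε) * μ univ := by
    intro j
    have h := eventually_lintegral_kernelConv_map_le (μ.map χ) hνac hB hνB hψm hψ (w j)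
      (b (Fin.castLE hd j)) (by positivity) (hflat j)
      (δ := ε / A * μ.real univ) (by positivity)
    rw [hmap, hmass] at h
    filter_upwards [h, self_mem_nhdsWithin] with σ h1 hσ
    refine (dirFisher_le_lintegral μ hμ hσ _ (b.orthonormal.1 _).le hA).trans ?_
    have e : ENNReal.ofReal (ε / A * μ.real univ) = ENNReal.ofReal (ε / A) * μ univ := by
      rw [ENNReal.ofReal_mul (by positivity), ofReal_measureReal]
    rw [e] at h1
    calc _ ≤ ENNReal.ofReal A *
            (ENNReal.ofReal (ε / A) * μ univ + ENNReal.ofReal (ε / A) * μ univ) +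
          ENNReal.ofReal ε * μ univ := by gcongr
      _ = (ENNReal.ofReal A * ENNReal.ofReal (ε / A) + ENNReal.ofReal A * ENNReal.ofReal (ε / A) +
          ENNReal.ofReal ε) * μ univ := by ring
      _ = _ := by
          rw [← ENNReal.ofReal_mul hA.le, mul_div_cancel₀ _ hA.ne',
            ← ENNReal.ofReal_add hε.le hε.le, ← ENNReal.ofReal_add (by positivity) hε.le]
          congr 2
          ring
  have hfin := eventuallyLossGe_of_dirFisher hd hμ b htan (by positivity)
  filter_upwards [hfin] with σ h s hs hint
  refine le_trans ?_ (h s hs hint)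
  have : (d : ℝ) * (3 * ε) / 2 ≤ δ := by
    have e : 3 * ((d : ℝ) + 1) * ε = 2 * δ := by rw [hεdef]; field_simp
    nlinarith
  nlinarith

/-- The global lower bound. Its constant `(n - d) / 2` is the limit of half the scaled Fisher
information. -/
lemma eventually_integral_ismLoss_ge (hd : d ≤ n) {M : Set 𝔼} (hM : IsEmbeddedSubmanifold d M)
    {μ : Measure 𝔼} [IsProbabilityMeasure μ]
    (hμ : μ ≪ (Measure.euclideanHausdorffMeasure d).restrict M) {δ : ℝ} (hδ : 0 < δ) :
    EventuallyLossGe μ (((n : ℝ) - d) / 2 + δ) := by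
  have hε : 0 < δ / (n + 1) := by positivity
  set ε := δ / (n + 1) with hεdef
  -- a countable subcover by small patches, of which finitely many carry all but `ε` of the mass
  choose! V hVo hxV hV using fun x (hx : x ∈ M) => exists_nhds_eventuallyLossGe hd hM hε hx
  have hMne : M.Nonempty := by
    rw [nonempty_iff_ne_empty]
    rintro rfl
    have h0 : μ univ = 0 := hμ (by simp)
    simp at h0
  obtain ⟨T, hTM, hTc, hT⟩ := TopologicalSpace.countable_cover_nhdsWithin
    (f := V) (s := M) fun x hx => mem_nhdsWithin_of_mem_nhds ((hVo x hx).mem_nhds (hxV x hx))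
  have hTne : T.Nonempty := by
    rw [nonempty_iff_ne_empty]
    rintro rfl
    obtain ⟨x, hx⟩ := hMne
    simpa using hT hx
  obtain ⟨t, rfl⟩ := hTc.exists_eq_range hTne
  have htM : ∀ k, t k ∈ M := fun k => hTM (mem_range_self k)
  have hcover : M ⊆ ⋃ k, V (t k) := by simpa using hT
  set W : ℕ → Set 𝔼 := fun k => ⋃ i ∈ Finset.range k, V (t i) with hW
  have hWm : ∀ k, MeasurableSet (W k) := fun k =>
    (isOpen_biUnion fun i _ => hVo _ (htM i)).measurableSet
  have hWmono : Monotone W := fun k l hkl =>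
    biUnion_subset_biUnion_left fun i hi => Finset.range_mono hkl hi
  have hWU : ⋃ k, W k = ⋃ k, V (t k) := by
    ext y
    simp only [hW, mem_iUnion, Finset.mem_range, exists_prop]
    exact ⟨fun ⟨_, i, _, h⟩ => ⟨i, h⟩, fun ⟨i, h⟩ => ⟨i + 1, i, Nat.lt_succ_self i, h⟩⟩
  have hfull : μ (⋃ k, W k) = 1 := by
    have hm : MeasurableSet (⋃ k, W k) := MeasurableSet.iUnion hWm
    rw [← prob_compl_eq_zero_iff hm]
    refine hμ ?_
    rw [Measure.restrict_apply hm.compl, hWU]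
    exact measure_mono_null (t := ∅) (fun y h => h.1 (hcover h.2)) measure_empty
  have htend : Tendsto (fun k => μ.real (W k)) atTop (𝓝 1) := by
    have h := tendsto_measure_iUnion_atTop (μ := μ) hWmono
    rw [hfull] at h
    exact (ENNReal.tendsto_toReal ENNReal.one_ne_top).comp h
  obtain ⟨k, hk⟩ := (htend.eventually (lt_mem_nhds (show 1 - ε < 1 by linarith))).exists
  have hac : ∀ S, μ.restrict S ≪ (Measure.euclideanHausdorffMeasure d).restrict M := fun S =>
    Measure.restrict_le_self.absolutelyContinuous.trans hμ
  have hWk : ∀ k, EventuallyLossGe (μ.restrict (W k)) (((n : ℝ) - d) / 2 + ε) := by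
    intro k
    induction k with
    | zero =>
      have : W 0 = ∅ := by simp [hW]
      rw [this, Measure.restrict_empty]
      exact EventuallyLossGe.zero _
    | succ k ih =>
      have hsucc : W (k + 1) = W k ∪ (V (t k) \ W k) := by
        rw [union_sdiff_self]
        simp only [hW, Finset.range_add_one, Finset.set_biUnion_insert, union_comm]
      have hVm := (hVo _ (htM k)).measurableSet
      rw [hsucc, Measure.restrict_union disjoint_sdiff_right (hVm.diff (hWm k))]
      refine ih.add (hV _ (htM k) _ inferInstance (hac _) ?_)
      rw [Measure.restrict_apply hVm.compl]
      exact measure_mono_null (t := ∅) (fun y h => h.1 h.2.1) measure_empty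
  filter_upwards [hWk k, self_mem_nhdsWithin] with σ h hσ s hs hint
  have hsplit : μ = μ.restrict (W k) + μ.restrict (W k)ᶜ :=
    (Measure.restrict_add_restrict_compl (hWm k)).symm
  rw [hsplit] at hint
  obtain ⟨i1, i2, e⟩ := integral_ismLoss_noised_add hint
  rw [← hsplit] at e
  have b1 := h s hs i1
  have b2 := neg_half_dim_le_integral_ismLoss _ hσ hs i2
  rw [measureReal_restrict_apply_univ] at b1 b2
  rw [probReal_compl_eq_one_sub (hWm k)] at b2
  rw [e, probReal_univ]
  have hle : μ.real (W k) ≤ 1 := measureReal_le_one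
  have hc : 0 ≤ ((n : ℝ) - d) / 2 + ε := by
    have : (d : ℝ) ≤ n := by exact_mod_cast hd
    linarith
  have e1 : ε * (n + 1) = δ := by rw [hεdef]; field_simp
  have hn : (0 : ℝ) ≤ n := by positivity
  have p1 : (((n : ℝ) - d) / 2 + ε) * μ.real (W k) ≤ (((n : ℝ) - d) / 2 + ε) * 1 :=
    mul_le_mul_of_nonneg_left hle hc
  have p2 : (n : ℝ) / 2 * (1 - μ.real (W k)) ≤ (n : ℝ) / 2 * ε :=
    mul_le_mul_of_nonneg_left (by linarith) (by positivity)
  nlinarith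

end Bound

theorem theorem2 {n d : ℕ} (hd : d ≤ n)
    (M : Set (EuclideanSpace ℝ (Fin n))) (hM : IsEmbeddedSubmanifold d M)
    (p : EuclideanSpace ℝ (Fin n) → ℝ) (hp : ContinuousOn p M) (hp0 : ∀ x ∈ M, 0 ≤ p x)
    (hprob : IsProbabilityMeasure (dataMeasure d M p)) :
    (d < n →
      ∃ σ₀ : ℝ, 0 < σ₀ ∧ ∀ σ : ℝ, 0 < σ → σ < σ₀ →
        ∀ s : EuclideanSpace ℝ (Fin n) → EuclideanSpace ℝ (Fin n), Differentiable ℝ s →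
          Integrable (ismLoss σ s) (noised (dataMeasure d M p) σ) →
          -((n : ℝ) - (d : ℝ)) ≤ ∫ x, ismLoss σ s x ∂(noised (dataMeasure d M p) σ)) ∧
    (∀ δ : ℝ, 0 < δ →
      ∃ σ₀ : ℝ, 0 < σ₀ ∧ ∀ σ : ℝ, 0 < σ → σ < σ₀ →
        ∀ s : EuclideanSpace ℝ (Fin n) → EuclideanSpace ℝ (Fin n), Differentiable ℝ s →
          Integrable (ismLoss σ s) (noised (dataMeasure d M p) σ) →
          -((n : ℝ) - (d : ℝ)) - δ ≤ ∫ x, ismLoss σ s x ∂(noised (dataMeasure d M p) σ)) := by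
  have hac : dataMeasure d M p ≪ (Measure.euclideanHausdorffMeasure d).restrict M :=
    withDensity_absolutelyContinuous _ _
  have key : ∀ δ : ℝ, 0 < δ → ∃ σ₀ : ℝ, 0 < σ₀ ∧ ∀ σ : ℝ, 0 < σ → σ < σ₀ →
      ∀ s : EuclideanSpace ℝ (Fin n) → EuclideanSpace ℝ (Fin n), Differentiable ℝ s →
        Integrable (ismLoss σ s) (noised (dataMeasure d M p) σ) →
        -(((n : ℝ) - d) / 2 + δ) ≤ ∫ x, ismLoss σ s x ∂(noised (dataMeasure d M p) σ) := by
    intro δ hδ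
    obtain ⟨σ₀, hσ₀, h⟩ := mem_nhdsGT_iff_exists_Ioo_subset.1
      (eventually_integral_ismLoss_ge hd hM hac hδ)
    refine ⟨σ₀, hσ₀, fun σ h1 h2 s hs hint => ?_⟩
    simpa using h ⟨h1, h2⟩ s hs hint
  refine ⟨fun hdn => ?_, fun δ hδ => ?_⟩
  · -- the bound is off by a factor of two, which leaves room for the error term
    have hpos : 0 < ((n : ℝ) - d) / 2 := by
      have : (d : ℝ) < n := by exact_mod_cast hdn
      linarith
    obtain ⟨σ₀, hσ₀, h⟩ := key _ hpos
    refine ⟨σ₀, hσ₀, fun σ h1 h2 s hs hint => ?_⟩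
    have := h σ h1 h2 s hs hint
    linarith
  · obtain ⟨σ₀, hσ₀, h⟩ := key δ hδ
    refine ⟨σ₀, hσ₀, fun σ h1 h2 s hs hint => ?_⟩
    have := h σ h1 h2 s hs hint
    have hdn : (d : ℝ) ≤ n := by exact_mod_cast hd
    linarith
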